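/- Let $X\subset\mathbb P^N$ be an irreducible closed subvariety over $\mathbb C$ of dimension $n$ and codimension $c=N-n$ which is nondegenerate, i.e. contained in no hyperplane. Let $\gamma_X:X_{\mathrm{sm}}\to\mathbb G(n,N)$, $x\mapsto\tilde T_xX$, be its Gauss map, sending a smooth point to its embedded tangent space, and let $g=\dim\overline{\gamma_X(X_{\mathrm{sm}})}$ be the Gauss dimension of $X$. Let $X_B$ be the Gauss map scroll of $X$, defined up to birational equivalence of $B$: take a Stein factorization $X\overset{\pi}{\dashrightarrow} B\overset{\tau}{\dashrightarrow}\mathbb G(n,N)$ of $\gamma_X$ ($B$ an irreducible variety, $\pi$ a dominant rational map with connected general fibres, $\tau$ generically finite onto its image), and for general $b\in B$ let the ruling $X_b\subset\mathbb P^N$ be the linear span of the fibre of $\pi|_{X_{\mathrm{sm}}}$ over $b$ (a general fibre is in fact a dense open subset of a linear space, so $X_b$ is just its closure). If $g(g-1)<c$, then $X_B$ is a subscroll of the linear dual of the tangent scroll of a variety of dimension at most $g$. That is: there are an irreducible closed subvariety $Y$ of the dual projective space $\check{\mathbb P}^N$ with $\dim Y\le g$ and a dominant rational map $\varphi:B\dashrightarrow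 Y$ such that for general $b\in B$ $$X_b\subseteq\bigl(\tilde T_{\varphi(b)}Y\bigr)^{\perp},$$ where $\tilde T_yY\subset\check{\mathbb P}^N$ is the embedded tangent space of $Y$ at $y$ and $L^\perp\subset\mathbb P^N$ denotes the linear subspace annihilated by a linear subspace $L\subset\check{\mathbb P}^N$. -/

import Mathlib

open scoped LinearAlgebra.Projectivization

noncomputable section

namespace GaussScroll

/-- The complex projective space with homogeneous coordinates indexed by `σ`. -/
abbrev PSpace (σ : Type) : Type := ℙ ℂ (σ → ℂ)

variable {σ ρ : Type}

/-- The Zariski topology on projective space, generated by the complements of the hypersurfaces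
`f = 0` with `f` a homogeneous polynomial. -/
instance zariskiTopology : TopologicalSpace (PSpace σ) :=
  TopologicalSpace.generateFrom
    {U | ∃ (f : MvPolynomial σ ℂ) (d : ℕ), f.IsHomogeneous d ∧
      U = {x : PSpace σ | MvPolynomial.eval x.rep f ≠ 0}}

/-- The (punctured) affine cone over a set of points of projective space. -/
def cone (Z : Set (PSpace σ)) : Set (σ → ℂ) :=
  {v | ∃ hv : v ≠ 0, Projectivization.mk ℂ v hv ∈ Z}

/-- The homogeneous ideal of all polynomials vanishing on the affine cone over `Z`. -/
def idealOf (Z : Set (PSpace σ)) : Ideal (MvPolynomial σ ℂ) :=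
  MvPolynomial.vanishingIdeal ℂ (cone Z)

/-- The dimension of (the Zariski closure of) a nonempty set `Z` of points of projective space:
the transcendence degree over `ℂ` of its homogeneous coordinate ring, minus one. -/
def dim (Z : Set (PSpace σ)) : ℕ :=
  Cardinal.toNat (Algebra.trdeg ℂ (MvPolynomial σ ℂ ⧸ idealOf Z)) - 1

/-- A projective variety: an irreducible (in particular nonempty) Zariski closed subset of
a projective space. -/
structure ProjVariety (σ : Type) where
  carrier : Set (PSpace σ)
  isClosed : IsClosed carrier
  isIrreducible : IsIrreducible carrier

/-- The property `P` holds at a general point of the variety `X`, that is, at all points of some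
nonempty (hence dense) open subset of `X`. -/
def ProjVariety.Generically (X : ProjVariety σ) (P : PSpace σ → Prop) : Prop :=
  ∃ U : Set (PSpace σ), IsOpen U ∧ (X.carrier ∩ U).Nonempty ∧ ∀ x ∈ X.carrier ∩ U, P x

/-- `X` is contained in no hyperplane. -/
def ProjVariety.Nondegenerate {N : ℕ} (X : ProjVariety (Fin (N + 1))) : Prop :=
  ∀ w : Fin (N + 1) → ℂ, w ≠ 0 → ∃ x ∈ X.carrier, w ⬝ᵥ x.rep ≠ 0

/-- The codimension of `X` in `ℙ^N`. -/
def ProjVariety.codim {N : ℕ} (X : ProjVariety (Fin (N + 1))) : ℕ :=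
  N - dim X.carrier

/-! ### Rational maps -/

/-- (A representative of) a rational map from the projective variety `X` to a projective space:
a tuple of homogeneous polynomials of the same degree which do not all vanish identically
on `X`. -/
structure RatMap (X : ProjVariety σ) (ρ : Type) where
  deg : ℕ
  poly : ρ → MvPolynomial σ ℂ
  homogeneous : ∀ i, (poly i).IsHomogeneous deg
  not_zero : ∃ x ∈ X.carrier, ∃ i, MvPolynomial.eval x.rep (poly i) ≠ 0

/-- `F.MapsTo x y`: `x` is a point of `X` at which the tuple representing `F` does not vanish,
and `F` maps `x` to `y`. -/
def RatMap.MapsTo {X : ProjVariety σ} (F : RatMap X ρ) (x : PSpace σ) (y : PSpace ρ) : Prop :=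
  x ∈ X.carrier ∧
    ∃ h : (fun i => MvPolynomial.eval x.rep (F.poly i)) ≠ 0,
      Projectivization.mk ℂ (fun i => MvPolynomial.eval x.rep (F.poly i)) h = y

/-- `F` is a dominant rational map from `X` to the variety `Y`. -/
def RatMap.Dominant {X : ProjVariety σ} (F : RatMap X ρ) (Y : ProjVariety ρ) : Prop :=
  closure {y | ∃ x, F.MapsTo x y} = Y.carrier

/-- `F` is generically finite to its image: on some nonempty open subset of `X`, its fibres
are finite. -/
def RatMap.GenericallyFinite {X : ProjVariety σ} (F : RatMap X ρ) : Prop :=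
  ∃ U : Set (PSpace σ), IsOpen U ∧ (X.carrier ∩ U).Nonempty ∧
    ∀ x ∈ X.carrier ∩ U,
      {x' | x' ∈ X.carrier ∩ U ∧ ∃ y, F.MapsTo x y ∧ F.MapsTo x' y}.Finite

/-! ### Embedded tangent spaces and the Gauss map -/

variable {N : ℕ}

/-- The embedded tangent space of `X ⊆ ℙ^N` at `x`, as a linear subspace of `ℂ^{N+1}`: the common
zero locus of the differentials at `x` of all polynomials that vanish on `X`. -/
def ProjVariety.tangent (X : ProjVariety (Fin (N + 1))) (x : PSpace (Fin (N + 1))) :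
    Submodule ℂ (Fin (N + 1) → ℂ) where
  carrier := {v | ∀ f ∈ idealOf X.carrier,
    ∑ i, v i * MvPolynomial.eval x.rep (MvPolynomial.pderiv i f) = 0}
  add_mem' := by
    intro v w hv hw f hf
    simp only [Pi.add_apply, add_mul, Finset.sum_add_distrib, hv f hf, hw f hf, add_zero]
  zero_mem' := by
    intro f _
    simp
  smul_mem' := by
    intro c v hv f hf
    simp only [Pi.smul_apply, smul_eq_mul, mul_assoc, ← Finset.mul_sum, hv f hf, mul_zero]

/-- The set of smooth points of `X`: the points at which the embedded tangent space has
(projective) dimension equal to `dim X`. -/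
def ProjVariety.smoothLocus (X : ProjVariety (Fin (N + 1))) : Set (PSpace (Fin (N + 1))) :=
  {x | x ∈ X.carrier ∧ Module.finrank ℂ (X.tangent x) = dim X.carrier + 1}

/-- The index set of the Plücker coordinates of `d`-dimensional subspaces of `ℂ^{N+1}`. -/
abbrev PluckerIndex (d N : ℕ) : Type := Fin d ↪o Fin (N + 1)

/-- The maximal minors of a `d × (N + 1)` matrix. -/
def minors {d : ℕ} (A : Matrix (Fin d) (Fin (N + 1)) ℂ) : PluckerIndex d N → ℂ :=
  fun e => (A.submatrix id e).det

/-- `p` is the image of the `d`-dimensional subspace `W` of `ℂ^{N+1}` under the Plücker embedding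
of the Grassmannian: it is given by the maximal minors of a matrix whose rows form a basis
of `W`. -/
def IsPluckerPoint {d : ℕ} (W : Submodule ℂ (Fin (N + 1) → ℂ))
    (p : PSpace (PluckerIndex d N)) : Prop :=
  ∃ A : Matrix (Fin d) (Fin (N + 1)) ℂ, Submodule.span ℂ (Set.range A.row) = W ∧
    ∃ h : minors A ≠ 0, Projectivization.mk ℂ (minors A) h = p

/-- The image of the smooth locus of `X` under the Gauss map, which sends a smooth point `x` to
the embedded tangent space at `x`, a point of the Grassmannian in its Plücker embedding. -/
def ProjVariety.gaussImage (X : ProjVariety (Fin (N + 1))) :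
    Set (PSpace (PluckerIndex (dim X.carrier + 1) N)) :=
  {p | ∃ x ∈ X.smoothLocus, IsPluckerPoint (X.tangent x) p}

/-- The Gauss dimension of `X`: the dimension of the closure of the image of its Gauss map. -/
def ProjVariety.gaussDim (X : ProjVariety (Fin (N + 1))) : ℕ :=
  dim (closure X.gaussImage)

/-! ### Scrolls -/

/-- A scroll in `ℙ^N`, given by a variety `base` and, for each point of the base, a linear subspace
of `ℂ^{N+1}` whose projectivization is the ruling over that point. Only the rulings over general
points of the base matter. -/
structure Scroll (N : ℕ) where
  σ : Type
  finite : Finite σ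
  base : ProjVariety σ
  ruling : PSpace σ → Submodule ℂ (Fin (N + 1) → ℂ)

/-- The annihilator of `W` in the dual space of `ℂ^{N+1}`, in dual coordinates. -/
def perp (W : Submodule ℂ (Fin (N + 1) → ℂ)) : Submodule ℂ (Fin (N + 1) → ℂ) where
  carrier := {w | ∀ v ∈ W, w ⬝ᵥ v = 0}
  add_mem' := by
    intro a b ha hb v hv
    rw [add_dotProduct, ha v hv, hb v hv, add_zero]
  zero_mem' := by
    intro v _
    exact zero_dotProduct v
  smul_mem' := by
    intro c a ha v hv
    rw [smul_dotProduct, ha v hv, smul_zero]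

/-- The linear dual of a scroll: the scroll over the same base, in the dual projective space (with
the dual coordinates), whose rulings are the annihilators of the given rulings. -/
def Scroll.linearDual (S : Scroll N) : Scroll N where
  σ := S.σ
  finite := S.finite
  base := S.base
  ruling := fun b => perp (S.ruling b)

/-- The tangent scroll of a projective variety `Y`, with base `Y` and whose ruling over `y` is the
embedded tangent space of `Y` at `y`. -/
def tangentScroll (Y : ProjVariety (Fin (N + 1))) : Scroll N where
  σ := Fin (N + 1)
  finite := inferInstance
  base := Y
  ruling := Y.tangent

/-- `S` is a subscroll of `S'`: along a dominant rational map from the base of `S` to the base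
of `S'`, the general ruling of `S` is contained in the corresponding ruling of `S'`. In other
words, `S` is contained, ruling by ruling, in the pullback of `S'` to the base of `S`. -/
def Scroll.IsSubscroll (S S' : Scroll N) : Prop :=
  ∃ φ : RatMap S.base S'.σ, φ.Dominant S'.base ∧
    S.base.Generically (fun b => ∃ b', φ.MapsTo b b' ∧ S.ruling b ≤ S'.ruling b')

/-- The part of the fibre of the rational map `π` over `b` that lies in the smooth locus of `X`. -/
def smoothFibre (X : ProjVariety (Fin (N + 1))) (π : RatMap X σ) (b : PSpace σ) :
    Set (PSpace (Fin (N + 1))) :=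
  {x | x ∈ X.smoothLocus ∧ π.MapsTo x b}

/-- `S` is a Gauss map scroll of `X` (which is determined only up to birational equivalence): there
is a Stein factorization `X ⇢ base ⇢ Grassmannian` of the Gauss map of `X`, with `π : X ⇢ base`
dominant with connected general fibres and `τ : base ⇢ Grassmannian` generically finite, such that
the general ruling of `S` is the linear space spanned by the corresponding fibre of `π`. (A general
fibre of the Gauss map is a dense open subset of a linear space, so that this span is just the
closure of the fibre. Such linearity is not assumed here.) -/
def IsGaussMapScroll (X : ProjVariety (Fin (N + 1))) (S : Scroll N) : Prop :=
  ∃ (π : RatMap X S.σ) (τ : RatMap S.base (PluckerIndex (dim X.carrier + 1) N)),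
    π.Dominant S.base ∧
    τ.GenericallyFinite ∧
    (∀ x ∈ X.smoothLocus, ∀ b p, π.MapsTo x b → τ.MapsTo b p →
      IsPluckerPoint (X.tangent x) p) ∧
    S.base.Generically (fun b => IsConnected (smoothFibre X π b)) ∧
    S.base.Generically (fun b =>
      S.ruling b = Submodule.span ℂ (cone (smoothFibre X π b)))

end GaussScroll

end

noncomputable section

namespace GaussScroll

open MvPolynomial

/-! ### Extension of derivations in characteristic zero -/

section DualNumbers

variable {k K : Type*} [Field k] [Field K] [Algebra k K]

/-! The inequality forces `c > 0`, so a hyperplane through each `T_xX` can be chosen algebraically: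
span `T_xX` together with `c - 1` fixed coordinate points. Its equation is linear in the Plücker
coordinates of `T_xX` (`sum_mul_eval_hyperplaneForm`), so composing with `τ` gives a map `φ` from
`B` to the dual space. Let `Y` be the closure of its image. It is a linear projection of the Gauss
image, whence `dim Y ≤ g` (`dim_le_dim_of_aeval_mem`).

The containment is half of the reflexivity argument. Put `H = φ ∘ π`. The hyperplane `H(x)` contains
`T_xX`, hence `x`, so `H(x) · x = 0` on `X`. Differentiating along `t ∈ T_xX` gives `H(x) · t +
dH(t) · x = 0`, where the first term vanishes; so `x` annihilates `dH(T_xX)`. In characteristic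
zero, generic smoothness (`exists_tan_lift`) makes this all of the tangent space of `Y` at `H(x)`;
see `IsGradientProjection.mem_of_dominant`.

The calculus takes place on affine cones at the generic point, with tangent vectors read as maps to
dual numbers. To reach actual points, `IsGradientProjection` encodes tangent spaces by finitely many
polynomials. Orthogonality then becomes membership in the ideal of `X`, valid at every point of `X`
over a general `b` (`generically_tangent_image_le_perp`). -/

theorem formallySmooth_of_charZero (k B K : Type*) [Field k] [CharZero k] [CommRing B]
    [Field K] [Algebra k B] [Algebra k K] [Algebra B K] [IsScalarTower k B K]
    [FaithfulSMul B K] [Algebra.EssFiniteType k K] : Algebra.FormallySmooth B K := by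
  have : IsDomain B := (FaithfulSMul.algebraMap_injective B K).isDomain
  let : Algebra (FractionRing B) K := FractionRing.liftAlgebra B K
  have : CharZero (FractionRing B) := charZero_of_injective_algebraMap
    (algebraMap k (FractionRing B)).injective
  have : IsScalarTower k (FractionRing B) K := by
    refine IsScalarTower.of_algebraMap_eq fun a => ?_
    rw [IsScalarTower.algebraMap_apply k B K, IsScalarTower.algebraMap_apply B (FractionRing B) K,
      ← IsScalarTower.algebraMap_apply k B (FractionRing B)]
  have : Algebra.EssFiniteType (FractionRing B) K := .of_comp k _ _
  -- Localizations are formally smooth, and so are finitely generated field extensions in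
  -- characteristic zero.
  have : Algebra.FormallySmooth B (FractionRing B) := .of_isLocalization (nonZeroDivisors B)
  exact .comp _ (FractionRing B) _

/-- Algebraic field extensions in characteristic zero are separable, hence unramified. This supplies
uniqueness of lifts, as formal smoothness supplies existence. -/
theorem formallyUnramified_of_isAlgebraic (k B K : Type*) [Field k] [CharZero k] [CommRing B]
    [Field K] [Algebra k B] [Algebra B K]
    [FaithfulSMul B K] [Algebra.IsAlgebraic B K] : Algebra.FormallyUnramified B K := by
  have : IsDomain B := (FaithfulSMul.algebraMap_injective B K).isDomain
  let : Algebra (FractionRing B) K := FractionRing.liftAlgebra B K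
  have : CharZero (FractionRing B) := charZero_of_injective_algebraMap
    (algebraMap k (FractionRing B)).injective
  have : Algebra.IsAlgebraic (FractionRing B) K := IsFractionRing.comap_isAlgebraic_iff.mp ‹_›
  have : Algebra.FormallyUnramified B (FractionRing B) := .of_isLocalization (nonZeroDivisors B)
  have : Algebra.FormallyUnramified (FractionRing B) K := .of_isSeparable _ _
  exact .comp _ (FractionRing B) _

theorem isNilpotent_ker_fst (k K : Type*) [CommRing k] [CommRing K] [Algebra k K] :
    IsNilpotent (RingHom.ker (TrivSqZeroExt.fstHom k K K : TrivSqZeroExt K K →+* K)) := by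
  refine ⟨2, ?_⟩
  refine le_bot_iff.1 ((pow_two (RingHom.ker (TrivSqZeroExt.fstHom k K K).toRingHom)).le.trans
    (Ideal.mul_le.2 ?_))
  intro r hr s hs
  have hr' : r.fst = 0 := hr
  have hs' : s.fst = 0 := hs
  rw [Ideal.mem_bot]
  ext <;> simp [hr', hs']

/-- A first order deformation of the inclusion of a domain into a finitely generated field
extends to the field. -/
theorem exists_algHom_extension [CharZero k] {B : Type*} [CommRing B] [Algebra k B] [Algebra B K]
    [IsScalarTower k B K] [FaithfulSMul B K] [Algebra.EssFiniteType k K]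
    (φ : B →ₐ[k] TrivSqZeroExt K K) (hφ : ∀ b, (φ b).fst = algebraMap B K b) :
    ∃ Φ : K →ₐ[k] TrivSqZeroExt K K, (∀ b, Φ (algebraMap B K b) = φ b) ∧
      ∀ a, (Φ a).fst = a := by
  have := formallySmooth_of_charZero k B K
  -- With this `B`-algebra structure, `B`-linearity of a lift says exactly that it extends `φ`.
  let algT : Algebra B (TrivSqZeroExt K K) := φ.toRingHom.toAlgebra
  let g : TrivSqZeroExt K K →ₐ[B] K :=
    { (TrivSqZeroExt.fstHom k K K).toRingHom with commutes' := hφ }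
  let Ψ : K →ₐ[B] TrivSqZeroExt K K := Algebra.FormallySmooth.liftOfSurjective (AlgHom.id B K) g
    (fun a => ⟨TrivSqZeroExt.inl a, rfl⟩) (isNilpotent_ker_fst k K)
  have h1 : ∀ b, Ψ (algebraMap B K b) = φ b := fun b => Ψ.commutes b
  refine ⟨{ Ψ.toRingHom with commutes' := fun a => ?_ }, h1, fun a => ?_⟩
  · change Ψ (algebraMap k K a) = _
    rw [IsScalarTower.algebraMap_apply k B K, h1, AlgHom.commutes]
  · exact Algebra.FormallySmooth.liftOfSurjective_apply (AlgHom.id B K) g _ _ a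

variable {σ ρ : Type*} [Fintype σ] [Fintype ρ]

/-- First-order Taylor expansion: tangent vectors at `p` correspond to homomorphisms to the dual
numbers lying over evaluation at `p`. -/
theorem aeval_trivSqZeroExt (p t : σ → K) (f : MvPolynomial σ k) :
    aeval (fun i => (TrivSqZeroExt.inl (p i) + TrivSqZeroExt.inr (t i) : TrivSqZeroExt K K)) f =
      TrivSqZeroExt.inl (aeval p f) +
        TrivSqZeroExt.inr (∑ i, t i * aeval p (pderiv i f)) := by
  classical
  induction f using MvPolynomial.induction_on with
  | C a =>
    simp only [← algebraMap_eq, AlgHom.commutes]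
    simp [TrivSqZeroExt.algebraMap_eq_inl']
  | add f g hf hg =>
    simp only [map_add, hf, hg, mul_add, Finset.sum_add_distrib, TrivSqZeroExt.inl_add,
      TrivSqZeroExt.inr_add]
    abel
  | mul_X f j hf =>
    rw [map_mul, hf, aeval_X]
    ext
    · simp
    · have h1 : ∀ i, t i * aeval p (pderiv i (f * X j)) =
          (if j = i then t i * aeval p f else 0) + p j * (t i * aeval p (pderiv i f)) := by
        intro i
        rw [pderiv_mul, pderiv_X, Pi.single_apply]
        split_ifs with h <;> simp [h] <;> ring
      simp only [h1, Finset.sum_add_distrib, Finset.sum_ite_eq, Finset.mem_univ, if_true,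
        ← Finset.mul_sum]
      simp
      ring

/-- The Zariski tangent space at `p` of the zero locus of `I`. -/
def tan {F : Type*} [CommRing F] [Algebra k F] (I : Ideal (MvPolynomial σ k)) (p : σ → F) :
    Submodule F (σ → F) where
  carrier := {t | ∀ f ∈ I, ∑ i, t i * aeval p (pderiv i f) = 0}
  add_mem' := by
    intro v w hv hw f hf
    simp only [Pi.add_apply, add_mul, Finset.sum_add_distrib, hv f hf, hw f hf, add_zero]
  zero_mem' := by
    intro f _
    simp
  smul_mem' := by
    intro c v hv f hf
    simp only [Pi.smul_apply, smul_eq_mul, mul_assoc, ← Finset.mul_sum, hv f hf, mul_zero]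

/-- Generic smoothness: tangent vectors at the image of a generic point lift to tangent vectors
at the generic point. -/
theorem exists_tan_lift [CharZero k] [Algebra.EssFiniteType k K] (x : σ → K)
    (H : ρ → MvPolynomial σ k) {w : ρ → K}
    (hw : w ∈ tan (RingHom.ker (aeval (R := k) fun j => aeval x (H j)))
      (fun j => aeval x (H j))) :
    ∃ t ∈ tan (RingHom.ker (aeval (R := k) x)) x,
      ∀ j, ∑ i, t i * aeval x (pderiv i (H j)) = w j := by
  set h : ρ → K := fun j => aeval x (H j) with hh
  let B := MvPolynomial ρ k ⧸ RingHom.ker (aeval (R := k) h)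
  let ι : B →ₐ[k] K := Ideal.kerLiftAlg (aeval (R := k) h)
  let : Algebra B K := ι.toRingHom.toAlgebra
  have : IsScalarTower k B K := IsScalarTower.of_algebraMap_eq fun a => (ι.commutes a).symm
  have : FaithfulSMul B K := (faithfulSMul_iff_algebraMap_injective B K).2
    (Ideal.kerLiftAlg_injective (aeval (R := k) h))
  -- Tangency of `w` is what makes this deformation well defined on the coordinate ring `B` of the
  -- image. Its extension to `K` displaces the coordinates of `x` by the required `t`.
  let φ : B →ₐ[k] TrivSqZeroExt K K := Ideal.Quotient.liftₐ _
    (aeval (fun j => (TrivSqZeroExt.inl (h j) + TrivSqZeroExt.inr (w j) : TrivSqZeroExt K K))) (by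
      intro f hf
      rw [aeval_trivSqZeroExt, hw f hf, RingHom.mem_ker.1 hf]
      simp)
  have hφ : ∀ f : MvPolynomial ρ k, φ (Ideal.Quotient.mk _ f) =
      aeval (fun j => (TrivSqZeroExt.inl (h j) + TrivSqZeroExt.inr (w j) : TrivSqZeroExt K K)) f :=
    fun f => rfl
  have hι : ∀ f : MvPolynomial ρ k, algebraMap B K (Ideal.Quotient.mk _ f) = aeval h f :=
    fun f => rfl
  obtain ⟨Φ, hΦ, hfst⟩ := exists_algHom_extension φ (by
    intro b
    obtain ⟨f, rfl⟩ := Ideal.Quotient.mk_surjective b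
    rw [hφ, hι, aeval_trivSqZeroExt]
    simp)
  have key : ∀ f : MvPolynomial σ k, Φ (aeval x f) = TrivSqZeroExt.inl (aeval x f) +
        TrivSqZeroExt.inr (∑ i, (Φ (x i)).snd * aeval x (pderiv i f)) := by
    intro f
    rw [← aeval_trivSqZeroExt, ← AlgHom.comp_apply]
    congr 1
    ext i
    · simp [hfst]
    · simp
  refine ⟨fun i => (Φ (x i)).snd, fun f hf => ?_, fun j => ?_⟩
  · have := key f
    rw [RingHom.mem_ker.1 hf, map_zero] at this
    simpa using congrArg TrivSqZeroExt.snd this.symm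
  · have h1 := key (H j)
    have h2 : Φ (h j) = TrivSqZeroExt.inl (h j) + TrivSqZeroExt.inr (w j) := by
      have := hΦ (Ideal.Quotient.mk _ (X j))
      rwa [hι, hφ, aeval_X, aeval_X] at this
    have h3 := h1.symm.trans h2
    simpa using congrArg TrivSqZeroExt.snd h3

end DualNumbers

/-! ### The tangent space at the generic point -/

section GenericPoint

variable {k : Type*} [Field k] {σ : Type*}

/-- The function field of the zero locus of a prime ideal. -/
abbrev FunctionField (I : Ideal (MvPolynomial σ k)) : Type _ :=
  FractionRing (MvPolynomial σ k ⧸ I)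

/-- The generic point of the zero locus of a prime ideal. -/
def genericPoint (I : Ideal (MvPolynomial σ k)) : σ → FunctionField I :=
  fun i => algebraMap (MvPolynomial σ k ⧸ I) _ (Ideal.Quotient.mk I (X i))

theorem aeval_genericPoint (I : Ideal (MvPolynomial σ k)) (f : MvPolynomial σ k) :
    aeval (genericPoint I) f =
      algebraMap (MvPolynomial σ k ⧸ I) (FunctionField I) (Ideal.Quotient.mk I f) := by
  have : aeval (genericPoint I) = ((IsScalarTower.toAlgHom k (MvPolynomial σ k ⧸ I)
      (FunctionField I)).comp (Ideal.Quotient.mkₐ k I)) := by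
    ext i
    simp [genericPoint]
  rw [this]
  rfl

theorem aeval_genericPoint_eq_zero (I : Ideal (MvPolynomial σ k)) {f : MvPolynomial σ k} :
    aeval (genericPoint I) f = 0 ↔ f ∈ I := by
  rw [aeval_genericPoint, IsFractionRing.to_map_eq_zero_iff, Ideal.Quotient.eq_zero_iff_mem]

theorem ker_aeval_genericPoint (I : Ideal (MvPolynomial σ k)) [I.IsPrime] :
    RingHom.ker (aeval (R := k) (genericPoint I)) = I := by
  ext f
  exact aeval_genericPoint_eq_zero I

variable [Fintype σ]

instance (I : Ideal (MvPolynomial σ k)) : Algebra.EssFiniteType k (FunctionField I) :=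
  have : Algebra.EssFiniteType (MvPolynomial σ k ⧸ I) (FunctionField I) :=
    .of_isLocalization _ (nonZeroDivisors _)
  .comp k (MvPolynomial σ k ⧸ I) _

/-- A first order deformation of the inclusion of a domain into its fraction field is trivial if
it is trivial on a transcendence basis. -/
theorem eq_inl_of_isTranscendenceBasis {A K : Type*} [CharZero k] [CommRing A] [IsDomain A]
    [Algebra k A] [Field K] [Algebra A K] [Algebra k K] [IsScalarTower k A K] [IsFractionRing A K]
    {s : Set A} (hs : IsTranscendenceBasis k ((↑) : s → A)) (φ : A →ₐ[k] TrivSqZeroExt K K)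
    (hφ : ∀ a, (φ a).fst = algebraMap A K a)
    (h0 : ∀ a ∈ s, φ a = TrivSqZeroExt.inl (algebraMap A K a)) (a : A) :
    φ a = TrivSqZeroExt.inl (algebraMap A K a) := by
  let B := Algebra.adjoin k (Set.range ((↑) : s → A))
  have : Algebra.IsAlgebraic B A := hs.isAlgebraic
  have : Algebra.IsAlgebraic A K := IsLocalization.isAlgebraic _ (nonZeroDivisors A)
  have : Algebra.IsAlgebraic B K := .trans B A K
  have hBK : Function.Injective (algebraMap B K) :=
    (IsFractionRing.injective A K).comp Subtype.val_injective
  have : FaithfulSMul B K := (faithfulSMul_iff_algebraMap_injective B K).2 hBK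
  have := formallyUnramified_of_isAlgebraic k B K
  have hunit : ∀ y : nonZeroDivisors A, IsUnit (φ y) := fun y => by
    rw [TrivSqZeroExt.isUnit_iff_isUnit_fst, hφ, isUnit_iff_ne_zero]
    exact IsFractionRing.to_map_ne_zero_of_mem_nonZeroDivisors y.2
  let Φ : K →ₐ[k] TrivSqZeroExt K K := IsLocalization.liftAlgHom hunit
  have hΦ : ∀ a, Φ (algebraMap A K a) = φ a := fun a => IsLocalization.lift_eq _ _
  have hB : ∀ b : B, Φ (algebraMap B K b) = algebraMap B (TrivSqZeroExt K K) b := by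
    rintro ⟨b, hb⟩
    change (Φ.comp (IsScalarTower.toAlgHom k A K)) b =
      ((TrivSqZeroExt.inlAlgHom k K K).comp (IsScalarTower.toAlgHom k A K)) b
    refine AlgHom.eqOn_adjoin_iff.2 ?_ hb
    rintro _ ⟨l, rfl⟩
    exact (hΦ _).trans (h0 _ l.2)
  -- Both `Φ` and the trivial deformation are `B`-linear lifts of the identity of `K`, and `K` is
  -- unramified over `B`.
  let Φ₁ : K →ₐ[B] TrivSqZeroExt K K := { Φ.toRingHom with commutes' := hB }
  have hΦΦ : Φ₁ = TrivSqZeroExt.inlAlgHom B K K := by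
    refine Algebra.FormallyUnramified.lift_unique_of_ringHom
      (TrivSqZeroExt.fstHom k K K : TrivSqZeroExt K K →+* K) (isNilpotent_ker_fst k K) _ _ ?_
    refine IsLocalization.ringHom_ext (nonZeroDivisors A) (RingHom.ext fun a => ?_)
    change (Φ (algebraMap A K a)).fst = algebraMap A K a
    rw [hΦ, hφ]
  rw [← hΦ]
  exact DFunLike.congr_fun hΦΦ (algebraMap A K a)

/-- A tangent vector at the generic point that annihilates a transcendence basis vanishes. -/
theorem eq_zero_of_mem_tan_genericPoint [CharZero k] (I : Ideal (MvPolynomial σ k)) [I.IsPrime]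
    {s : Set (MvPolynomial σ k ⧸ I)}
    (hs : IsTranscendenceBasis k ((↑) : s → MvPolynomial σ k ⧸ I))
    (S : s → MvPolynomial σ k) (hS : ∀ l, Ideal.Quotient.mk I (S l) = l)
    {t : σ → FunctionField I} (ht : t ∈ tan I (genericPoint I))
    (h0 : ∀ l, ∑ i, t i * aeval (genericPoint I) (pderiv i (S l)) = 0) : t = 0 := by
  let φ : (MvPolynomial σ k ⧸ I) →ₐ[k] TrivSqZeroExt (FunctionField I) (FunctionField I) :=
    Ideal.Quotient.liftₐ _ (aeval (fun j => (TrivSqZeroExt.inl (genericPoint I j) +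
      TrivSqZeroExt.inr (t j) : TrivSqZeroExt (FunctionField I) (FunctionField I)))) (by
      intro f hf
      rw [aeval_trivSqZeroExt, ht f hf, (aeval_genericPoint_eq_zero I).2 hf]
      simp)
  have hφ : ∀ f : MvPolynomial σ k, φ (Ideal.Quotient.mk _ f) =
      TrivSqZeroExt.inl (algebraMap _ _ (Ideal.Quotient.mk I f)) +
        TrivSqZeroExt.inr (∑ i, t i * aeval (genericPoint I) (pderiv i f)) := fun f => by
    rw [← aeval_genericPoint]
    exact aeval_trivSqZeroExt (genericPoint I) t f
  have key := eq_inl_of_isTranscendenceBasis hs φ (fun a => by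
      obtain ⟨f, rfl⟩ := Ideal.Quotient.mk_surjective a
      rw [hφ]
      simp) (fun a ha => by
      obtain ⟨l, rfl⟩ : ∃ l : s, (l : MvPolynomial σ k ⧸ I) = a := ⟨⟨a, ha⟩, rfl⟩
      rw [← hS l, hφ, h0]
      simp)
  classical
  funext i
  have h1 := congrArg TrivSqZeroExt.snd ((hφ (X i)).symm.trans (key _))
  simpa [pderiv_X, Pi.single_apply, apply_ite, mul_ite] using h1

/-- The differentials of a transcendence basis are coordinates on the tangent space. They are
jointly injective because the field is unramified over the basis, and surjective because independent
elements satisfy no relation, so every `w` is tangent and lifts. -/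
theorem finrank_tan_genericPoint [CharZero k] (I : Ideal (MvPolynomial σ k)) [I.IsPrime] :
    Module.finrank (FunctionField I) (tan I (genericPoint I)) =
      Cardinal.toNat (Algebra.trdeg k (MvPolynomial σ k ⧸ I)) := by
  let A := MvPolynomial σ k ⧸ I
  let K := FunctionField I
  let x := genericPoint I
  obtain ⟨s, hs⟩ := exists_isTranscendenceBasis k A
  have hcard := hs.cardinalMk_eq_trdeg
  have : Finite s := by
    rw [← Cardinal.lt_aleph0_iff_finite, hcard]
    exact trdeg_lt_aleph0_of_finiteType
  have := Fintype.ofFinite s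
  choose S hS using fun l : s => Ideal.Quotient.mk_surjective (l : A)
  have hSx : ∀ l, aeval x (S l) = algebraMap A K l := fun l => by
    rw [aeval_genericPoint, hS]
  let T : tan I x →ₗ[K] (s → K) :=
    { toFun := fun t l => ∑ i, t.1 i * aeval x (pderiv i (S l))
      map_add' := fun t u => by
        funext l
        simp [add_mul, Finset.sum_add_distrib]
      map_smul' := fun c t => by
        funext l
        simp only [Submodule.coe_smul, Pi.smul_apply, smul_eq_mul, mul_assoc, RingHom.id_apply]
        exact (Finset.mul_sum _ _ _).symm }
  have hinj : Function.Injective T := by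
    rw [← LinearMap.ker_eq_bot, LinearMap.ker_eq_bot']
    intro t ht
    exact Subtype.ext (eq_zero_of_mem_tan_genericPoint I hs S hS t.2 fun l => congrFun ht l)
  have hsurj : Function.Surjective T := by
    intro w
    have hind : AlgebraicIndependent k (fun l : s => aeval x (S l)) := by
      simp only [hSx]
      exact hs.1.map' (f := IsScalarTower.toAlgHom k A K) (IsFractionRing.injective A K)
    obtain ⟨t, ht, htw⟩ := exists_tan_lift (w := w) x S (by
      intro f hf
      have : f = 0 := (injective_iff_map_eq_zero _).1 hind f hf
      simp [this])
    rw [ker_aeval_genericPoint I] at ht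
    exact ⟨⟨t, ht⟩, funext htw⟩
  rw [(LinearEquiv.ofBijective T ⟨hinj, hsurj⟩).finrank_eq, Module.finrank_fintype_fun_eq_card,
    ← hcard, Cardinal.mk_fintype, Cardinal.toNat_natCast]

end GenericPoint

/-! ### Gradients -/

/-- Over the fraction field there is a linear projection onto the span of `G`; clear the
denominators of the images of the standard basis vectors. -/
theorem exists_span_projection {A ι : Type*} [CommRing A] [IsDomain A] [Fintype ι]
    (G : Submodule A (ι → A)) : ∃ d : A, d ≠ 0 ∧ ∃ Q : ι → ι → A, (∀ i, Q i ∈ G) ∧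
      ∀ g ∈ G, ∀ j, ∑ i, g i * Q i j = d * g j := by
  classical
  let K := FractionRing A
  let m : (ι → A) → (ι → K) := fun g i => algebraMap A K (g i)
  let M : Submodule K (ι → K) := Submodule.span K (m '' G)
  have hM : ∀ u ∈ M, ∃ d : A, d ≠ 0 ∧ ∃ q ∈ G, ∀ j, algebraMap A K d * u j = m q j := by
    intro u hu
    induction hu using Submodule.span_induction with
    | mem u hu =>
      obtain ⟨g, hg, rfl⟩ := hu
      exact ⟨1, one_ne_zero, g, hg, fun j => by simp⟩
    | zero => exact ⟨1, one_ne_zero, 0, G.zero_mem, fun j => by simp [m]⟩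
    | add u v _ _ hu hv =>
      obtain ⟨d, hd, q, hq, h⟩ := hu
      obtain ⟨e, he, r, hr, h'⟩ := hv
      refine ⟨d * e, mul_ne_zero hd he, e • q + d • r,
        G.add_mem (G.smul_mem _ hq) (G.smul_mem _ hr), fun j => ?_⟩
      have h1 := h j
      have h2 := h' j
      simp only [m] at h1 h2
      simp only [m, Pi.add_apply, Pi.smul_apply, smul_eq_mul, map_add, map_mul, ← h1, ← h2]
      ring
    | smul c u _ hu =>
      obtain ⟨d, hd, q, hq, h⟩ := hu
      obtain ⟨a, b, hb, rfl⟩ := IsFractionRing.div_surjective (A := A) c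
      have hb0 : b ≠ 0 := nonZeroDivisors.ne_zero hb
      refine ⟨b * d, mul_ne_zero hb0 hd, a • q, G.smul_mem _ hq, fun j => ?_⟩
      have h1 := h j
      have : algebraMap A K b ≠ 0 := by simpa using hb0
      simp only [m] at h1
      simp only [m, Pi.smul_apply, smul_eq_mul, map_mul, ← h1]
      calc _ = (algebraMap A K b * (algebraMap A K a / algebraMap A K b)) *
            (algebraMap A K d * u j) := by ring
        _ = _ := by rw [mul_div_cancel₀ _ this]
  obtain ⟨g, hg⟩ := LinearMap.exists_leftInverse_of_injective M.subtype M.ker_subtype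
  choose d hd q hq h using fun i => hM _ (g (Pi.single i 1)).2
  refine ⟨∏ i, d i, Finset.prod_ne_zero_iff.2 fun i _ => hd i,
    fun i => (∏ j ∈ Finset.univ.erase i, d j) • q i, fun i => G.smul_mem _ (hq i),
    fun u hu j => IsFractionRing.injective A K ?_⟩
  have h1 : g (m u) = ⟨m u, Submodule.subset_span ⟨u, hu, rfl⟩⟩ :=
    LinearMap.congr_fun hg ⟨m u, Submodule.subset_span ⟨u, hu, rfl⟩⟩
  have h2 : m u j = ∑ i, m u i * (g (Pi.single i 1)).1 j := by
    have h3 : m u = ∑ i, m u i • (Pi.single i 1 : ι → K) := by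
      funext l
      simp [Finset.sum_apply, Pi.single_apply]
    conv_lhs => rw [show m u = ((g (m u) : M) : ι → K) by rw [h1]]
    conv_lhs => rw [h3]
    simp [map_sum, Finset.sum_apply]
  rw [map_sum, map_mul]
  change _ = _ * m u j
  rw [h2, Finset.mul_sum]
  refine Finset.sum_congr rfl fun i _ => ?_
  rw [← Finset.mul_prod_erase Finset.univ d (Finset.mem_univ i)]
  have := h i j
  simp only [m] at this ⊢
  simp only [Pi.smul_apply, smul_eq_mul, map_mul, ← this]
  ring

section Gradient

variable {k σ : Type*} [Field k] [Fintype σ]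

/-- `D` and `f` describe, over the locus `D ≠ 0`, a projection onto the space spanned by the
gradients of the elements of `I`. -/
structure IsGradientProjection (I : Ideal (MvPolynomial σ k)) (D : MvPolynomial σ k)
    (f : σ → MvPolynomial σ k) : Prop where
  notMem : D ∉ I
  mem : ∀ i, f i ∈ I
  proj : ∀ g ∈ I, ∀ j, ∑ i, pderiv i g * pderiv j (f i) - D * pderiv j g ∈ I

/-- Modulo `I` the gradients of elements of `I` form a submodule, since the term `g ∇a` of `∇(a g)`
vanishes modulo `I`. -/
theorem exists_isGradientProjection (I : Ideal (MvPolynomial σ k)) [I.IsPrime] :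
    ∃ D f, IsGradientProjection I D f := by
  let G : Submodule (MvPolynomial σ k ⧸ I) (σ → MvPolynomial σ k ⧸ I) :=
    { carrier := {u | ∃ g ∈ I, ∀ i, u i = Ideal.Quotient.mk I (pderiv i g)}
      add_mem' := by
        rintro u v ⟨g, hg, hu⟩ ⟨h, hh, hv⟩
        exact ⟨g + h, I.add_mem hg hh, fun i => by simp [hu, hv]⟩
      zero_mem' := ⟨0, I.zero_mem, fun i => by simp⟩
      smul_mem' := by
        rintro c u ⟨g, hg, hu⟩
        obtain ⟨a, rfl⟩ := Ideal.Quotient.mk_surjective c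
        refine ⟨a * g, I.mul_mem_left _ hg, fun i => ?_⟩
        simp [hu, Derivation.leibniz, Ideal.Quotient.eq_zero_iff_mem.2 hg] }
  obtain ⟨d, hd, Q, hQ, h⟩ := exists_span_projection G
  obtain ⟨D, rfl⟩ := Ideal.Quotient.mk_surjective d
  choose f hf hfQ using hQ
  refine ⟨D, f, fun hD => hd (Ideal.Quotient.eq_zero_iff_mem.2 hD), hf, fun g hg j => ?_⟩
  have := h (fun i => Ideal.Quotient.mk I (pderiv i g)) ⟨g, hg, fun i => rfl⟩ j
  rw [← Ideal.Quotient.eq_zero_iff_mem]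
  simp only [hfQ] at this
  simp [this]

variable {I : Ideal (MvPolynomial σ k)} {D : MvPolynomial σ k} {f : σ → MvPolynomial σ k}
  {F : Type*} [Field F] [Algebra k F] {p : σ → F}

theorem IsGradientProjection.sum_eq (h : IsGradientProjection I D f)
    (hp : ∀ g ∈ I, aeval p g = 0) {g : MvPolynomial σ k} (hg : g ∈ I) (j : σ) :
    ∑ i, aeval p (pderiv i g) * aeval p (pderiv j (f i)) = aeval p D * aeval p (pderiv j g) := by
  have := hp _ (h.proj g hg j)
  simpa [sub_eq_zero] using this

theorem IsGradientProjection.mem_tan_iff (h : IsGradientProjection I D f)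
    (hp : ∀ g ∈ I, aeval p g = 0) (hD : aeval p D ≠ 0) {t : σ → F} :
    t ∈ tan I p ↔ ∀ i, ∑ j, t j * aeval p (pderiv j (f i)) = 0 := by
  refine ⟨fun ht i => ht _ (h.mem i), fun ht g hg => ?_⟩
  refine (mul_eq_zero.1 ?_).resolve_left hD
  rw [Finset.mul_sum]
  calc ∑ j, aeval p D * (t j * aeval p (pderiv j g))
      = ∑ j, ∑ i, t j * (aeval p (pderiv i g) * aeval p (pderiv j (f i))) := by
        refine Finset.sum_congr rfl fun j _ => ?_
        rw [← Finset.mul_sum, h.sum_eq hp hg]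
        ring
    _ = ∑ i, aeval p (pderiv i g) * ∑ j, t j * aeval p (pderiv j (f i)) := by
        rw [Finset.sum_comm]
        refine Finset.sum_congr rfl fun i _ => ?_
        rw [Finset.mul_sum]
        exact Finset.sum_congr rfl fun j _ => by ring
    _ = 0 := by simp [ht]

/-- The matrix `(∂_j f_i) / D` is idempotent with kernel the tangent space, and the trace of an
idempotent is its rank. The dimension thus becomes a polynomial identity, transferable between
points. -/
theorem IsGradientProjection.finrank_tan (h : IsGradientProjection I D f)
    (hp : ∀ g ∈ I, aeval p g = 0) (hD : aeval p D ≠ 0) :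
    ((Fintype.card σ : F) - Module.finrank F (tan I p)) * aeval p D =
      aeval p (∑ i, pderiv i (f i)) := by
  classical
  let Q : Matrix σ σ F := Matrix.of fun i j => aeval p (pderiv j (f i)) / aeval p D
  have hker : tan I p = LinearMap.ker (Matrix.toLin' Q) := by
    ext t
    rw [h.mem_tan_iff hp hD, LinearMap.mem_ker, Matrix.toLin'_apply, funext_iff]
    refine forall_congr' fun i => ?_
    have : (Matrix.mulVec Q t) i = (∑ j, t j * aeval p (pderiv j (f i))) / aeval p D := by
      rw [Finset.sum_div]
      exact Finset.sum_congr rfl fun j _ => by simp [Q]; ring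
    rw [this, Pi.zero_apply, div_eq_zero_iff, or_iff_left hD]
  -- The projection identity applied to `g = f i`.
  have hQ : Q * Q = Q := by
    ext i j
    have := h.sum_eq hp (h.mem i) j
    rw [Matrix.mul_apply]
    simp only [Q, Matrix.of_apply, div_mul_div_comm, ← Finset.sum_div, this]
    field_simp
  have hidem : IsIdempotentElem (Matrix.toLin' Q) := by
    rw [IsIdempotentElem, Module.End.mul_eq_comp, ← Matrix.toLin'_mul, hQ]
  obtain ⟨q, hq⟩ := (LinearMap.isProj_iff_isIdempotentElem _).2 hidem
  have hrange : LinearMap.range (Matrix.toLin' Q) = q := hq.range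
  have htr := hq.trace
  rw [← hrange, Matrix.trace_toLin'_eq] at htr
  have hrn := LinearMap.finrank_range_add_finrank_ker (Matrix.toLin' Q)
  rw [Module.finrank_fintype_fun_eq_card] at hrn
  rw [hker, ← hrn, Nat.cast_add, add_sub_cancel_right, ← htr, Matrix.trace, Finset.sum_mul, map_sum]
  refine Finset.sum_congr rfl fun i _ => ?_
  simp only [Q, Matrix.diag_apply, Matrix.of_apply]
  field_simp

/-- At the generic point the trace identity is a membership in `I`, so it specializes to `p` and
gives the same rank there. -/
theorem IsGradientProjection.finrank_tan_eq_trdeg [CharZero k] [I.IsPrime]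
    (h : IsGradientProjection I D f) {p : σ → k}
    (hp : ∀ g ∈ I, eval p g = 0) (hD : eval p D ≠ 0) :
    Module.finrank k (tan I p) = Cardinal.toNat (Algebra.trdeg k (MvPolynomial σ k ⧸ I)) := by
  have h1 := h.finrank_tan (p := p) hp hD
  have h2 := h.finrank_tan (p := genericPoint I)
    (fun g hg => (aeval_genericPoint_eq_zero I).2 hg)
    (fun hD => h.notMem ((aeval_genericPoint_eq_zero I).1 hD))
  rw [finrank_tan_genericPoint] at h2
  set r := Cardinal.toNat (Algebra.trdeg k (MvPolynomial σ k ⧸ I))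
  have h3 : C ((Fintype.card σ : k) - r) * D - ∑ i, pderiv i (f i) ∈ I := by
    rw [← aeval_genericPoint_eq_zero, map_sub, ← h2, map_mul, aeval_C]
    simp
  have h4 := hp _ h3
  rw [map_sub, map_mul, eval_C, sub_eq_zero] at h4
  have h5 := mul_right_cancel₀ hD (h4.trans h1.symm)
  exact_mod_cast (sub_right_injective h5).symm

end Gradient

/-! ### Differentiating the incidence relation -/

/-- If `H` maps the zero locus of `I` dominantly onto the zero locus of `J`, and `H x` is
orthogonal both to `x` and to the tangent space at `x` for `x` generic, then `x` is orthogonal to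
the tangent space at `H x`. -/
theorem IsGradientProjection.mem_of_dominant {k σ : Type*} [Field k] [CharZero k] [Fintype σ]
    {I J : Ideal (MvPolynomial σ k)} [I.IsPrime] {H : σ → MvPolynomial σ k}
    (hIJ : ∀ f, aeval H f ∈ I ↔ f ∈ J)
    (hT : ∀ t ∈ tan I (genericPoint I), ∑ i, t i * aeval (genericPoint I) (H i) = 0)
    (hE : ∑ i, X i * H i ∈ I) {D : MvPolynomial σ k} {f : σ → MvPolynomial σ k}
    (h : IsGradientProjection J D f) (j : σ) :
    aeval H D * X j - ∑ i, X i * aeval H (pderiv j (f i)) ∈ I := by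
  classical
  set x := genericPoint I
  have hcomp : ∀ g, aeval (fun i => aeval x (H i)) g = aeval x (aeval H g) := fun g => by
    rw [← AlgHom.comp_apply, comp_aeval]
  have hker : RingHom.ker (aeval (R := k) fun i => aeval x (H i)) = J := by
    ext g
    rw [RingHom.mem_ker, hcomp, aeval_genericPoint_eq_zero, hIJ]
  have hJ : ∀ g ∈ J, aeval x (aeval H g) = 0 := fun g hg =>
    (aeval_genericPoint_eq_zero I).2 ((hIJ g).2 hg)
  -- Column `j` of `D · 1 - (∂_j f_i)` at `H x`; by `h.proj` it is tangent to the zero locus of `J`.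
  let w : σ → FunctionField I := fun i =>
    (if i = j then aeval x (aeval H D) else 0) - aeval x (aeval H (pderiv j (f i)))
  obtain ⟨t, ht, htw⟩ := exists_tan_lift (w := w) x H (by
    rw [hker]
    intro g hg
    have h1 := hJ _ (h.proj g hg j)
    rw [map_sub, map_sub, sub_eq_zero, map_sum, map_sum] at h1
    simp only [w, sub_mul, Finset.sum_sub_distrib, ite_mul, zero_mul, Finset.sum_ite_eq',
      Finset.mem_univ, if_true, hcomp, sub_eq_zero]
    rw [← map_mul, ← map_mul, ← h1]
    refine Finset.sum_congr rfl fun i _ => ?_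
    rw [map_mul, map_mul, mul_comm])
  rw [ker_aeval_genericPoint I] at ht
  -- The product rule splits this into `t · H(x)`, zero by `hT`, and `x · dH(t) = x · w`.
  have h2 := ht _ hE
  have h3 : ∀ l, t l * aeval x (pderiv l (∑ i, X i * H i)) = t l * aeval x (H l) +
      ∑ i, x i * (t l * aeval x (pderiv l (H i))) := by
    intro l
    simp only [map_sum, Derivation.leibniz, smul_eq_mul, map_add, map_mul, aeval_X, pderiv_X,
      Finset.sum_add_distrib, mul_add, Finset.mul_sum]
    rw [add_comm]
    congr 1
    · rw [Finset.sum_eq_single l]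
      · simp
      · intro b _ hb
        simp [hb]
      · simp
    · exact Finset.sum_congr rfl fun i _ => by ring
  simp only [h3, Finset.sum_add_distrib] at h2
  rw [hT t ht, zero_add, Finset.sum_comm] at h2
  simp only [← Finset.mul_sum, htw] at h2
  rw [← aeval_genericPoint_eq_zero, map_sub, map_sum, map_mul, aeval_X, ← h2]
  simp only [w, mul_sub, Finset.sum_sub_distrib, mul_ite, mul_zero, Finset.sum_ite_eq',
    Finset.mem_univ, if_true, map_mul, aeval_X]
  rw [mul_comm]

/-! ### Cones and homogeneous ideals -/

section Cone

variable {σ : Type}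

theorem exists_smul_rep {v : σ → ℂ} (hv : v ≠ 0) :
    ∃ c : ℂ, c ≠ 0 ∧ v = c • (Projectivization.mk ℂ v hv).rep := by
  obtain ⟨a, ha⟩ := Projectivization.exists_smul_eq_mk_rep ℂ v hv
  refine ⟨(a⁻¹ : ℂˣ), Units.ne_zero _, ?_⟩
  rw [← ha, Units.smul_def, smul_smul, Units.inv_mul, one_smul]

theorem mem_cone {Z : Set (PSpace σ)} {v : σ → ℂ} :
    v ∈ cone Z ↔ ∃ z ∈ Z, ∃ c : ℂ, c ≠ 0 ∧ v = c • z.rep := by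
  constructor
  · rintro ⟨hv, hz⟩
    exact ⟨_, hz, exists_smul_rep hv⟩
  · rintro ⟨z, hz, c, hc, rfl⟩
    have hne : c • z.rep ≠ 0 := smul_ne_zero hc z.rep_nonzero
    refine ⟨hne, ?_⟩
    rwa [show Projectivization.mk ℂ (c • z.rep) hne = z by
      conv_rhs => rw [← z.mk_rep]
      exact (Projectivization.mk_eq_mk_iff' ℂ _ _ _ _).2 ⟨c, rfl⟩]

theorem rep_mem_cone {Z : Set (PSpace σ)} {z : PSpace σ} (hz : z ∈ Z) : z.rep ∈ cone Z :=
  mem_cone.2 ⟨z, hz, 1, one_ne_zero, (one_smul _ _).symm⟩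

theorem smul_mem_cone {Z : Set (PSpace σ)} {v : σ → ℂ} (hv : v ∈ cone Z) {c : ℂ} (hc : c ≠ 0) :
    c • v ∈ cone Z := by
  obtain ⟨z, hz, d, hd, rfl⟩ := mem_cone.1 hv
  exact mem_cone.2 ⟨z, hz, c * d, mul_ne_zero hc hd, smul_smul _ _ _⟩

theorem mem_idealOf {Z : Set (PSpace σ)} {f : MvPolynomial σ ℂ} :
    f ∈ idealOf Z ↔ ∀ v ∈ cone Z, eval v f = 0 := by
  rw [idealOf, mem_vanishingIdeal_iff]
  rfl

theorem eval_smul_of_isHomogeneous {f : MvPolynomial σ ℂ} {d : ℕ} (hf : f.IsHomogeneous d)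
    (c : ℂ) (v : σ → ℂ) : eval (c • v) f = c ^ d * eval v f := by
  rw [eval_eq, eval_eq, Finset.mul_sum]
  refine Finset.sum_congr rfl fun m hm => ?_
  have : ∑ i ∈ m.support, m i = d := (hf.degree_eq_sum_deg_support hm).symm
  simp only [Pi.smul_apply, smul_eq_mul, mul_pow, Finset.prod_mul_distrib,
    Finset.prod_pow_eq_pow_sum, this]
  ring

theorem eval_smul_eq_sum (f : MvPolynomial σ ℂ) (c : ℂ) (v : σ → ℂ) :
    eval (c • v) f =
      ∑ i ∈ Finset.range (f.totalDegree + 1), c ^ i * eval v (homogeneousComponent i f) := by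
  conv_lhs => rw [← sum_homogeneousComponent f]
  rw [map_sum]
  exact Finset.sum_congr rfl fun i _ =>
    eval_smul_of_isHomogeneous (homogeneousComponent_isHomogeneous i f) c v

/-- As a polynomial in `c`, `f (c • v)` has infinitely many roots, so its coefficients vanish. -/
theorem eval_homogeneousComponent_eq_zero {f : MvPolynomial σ ℂ} {v : σ → ℂ}
    (h : ∀ c : ℂ, c ≠ 0 → eval (c • v) f = 0) (n : ℕ) :
    eval v (homogeneousComponent n f) = 0 := by
  let p : Polynomial ℂ := ∑ i ∈ Finset.range (f.totalDegree + 1),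
    Polynomial.C (eval v (homogeneousComponent i f)) * Polynomial.X ^ i
  have hp : p = 0 := by
    refine Polynomial.eq_zero_of_infinite_isRoot p
      (Set.Infinite.mono (s := {0}ᶜ) (fun c hc => ?_) (Set.finite_singleton 0).infinite_compl)
    have h1 := h c hc
    rw [eval_smul_eq_sum] at h1
    simp only [Set.mem_ofPred_eq, Polynomial.IsRoot.def, p, Polynomial.eval_finsetSum,
      Polynomial.eval_mul, Polynomial.eval_C, Polynomial.eval_pow, Polynomial.eval_X]
    rw [← h1]
    exact Finset.sum_congr rfl fun i _ => mul_comm _ _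
  by_cases hn : n < f.totalDegree + 1
  · have h1 := congrArg (fun q => Polynomial.coeff q n) hp
    simpa [p, Polynomial.finsetSum_coeff, Polynomial.coeff_C_mul, Polynomial.coeff_X_pow, hn]
      using h1
  · rw [homogeneousComponent_eq_zero _ _ (by omega), map_zero]

theorem homogeneousComponent_mem_idealOf {Z : Set (PSpace σ)} {f : MvPolynomial σ ℂ}
    (hf : f ∈ idealOf Z) (n : ℕ) : homogeneousComponent n f ∈ idealOf Z :=
  mem_idealOf.2 fun _ hv => eval_homogeneousComponent_eq_zero
    (fun _ hc => mem_idealOf.1 hf _ (smul_mem_cone hv hc)) n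

theorem mem_of_homogeneousComponent_mem {I : Ideal (MvPolynomial σ ℂ)} {f : MvPolynomial σ ℂ}
    (h : ∀ n, homogeneousComponent n f ∈ I) : f ∈ I := by
  rw [← sum_homogeneousComponent f]
  exact I.sum_mem fun n _ => h n

theorem mem_idealOf_of_isHomogeneous {Z : Set (PSpace σ)} {f : MvPolynomial σ ℂ} {d : ℕ}
    (hf : f.IsHomogeneous d) : f ∈ idealOf Z ↔ ∀ z ∈ Z, eval z.rep f = 0 := by
  refine ⟨fun h z hz => mem_idealOf.1 h _ (rep_mem_cone hz), fun h => mem_idealOf.2 ?_⟩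
  intro v hv
  obtain ⟨z, hz, c, -, rfl⟩ := mem_cone.1 hv
  rw [eval_smul_of_isHomogeneous hf, h z hz, mul_zero]

theorem isOpen_ne_zero {f : MvPolynomial σ ℂ} {d : ℕ} (hf : f.IsHomogeneous d) :
    IsOpen {x : PSpace σ | eval x.rep f ≠ 0} :=
  TopologicalSpace.isOpen_generateFrom_of_mem ⟨f, d, hf, rfl⟩

theorem isClosed_eq_zero {f : MvPolynomial σ ℂ} {d : ℕ} (hf : f.IsHomogeneous d) :
    IsClosed {x : PSpace σ | eval x.rep f = 0} := by
  rw [← isOpen_compl_iff]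
  exact isOpen_ne_zero hf

theorem idealOf_closure (Z : Set (PSpace σ)) : idealOf (closure Z) = idealOf Z := by
  refine le_antisymm (fun f hf => mem_idealOf.2 fun v hv => ?_)
    fun f hf => mem_of_homogeneousComponent_mem fun n => ?_
  · obtain ⟨z, hz, c, hc, rfl⟩ := mem_cone.1 hv
    exact mem_idealOf.1 hf _ (mem_cone.2 ⟨z, subset_closure hz, c, hc, rfl⟩)
  · have hn := homogeneousComponent_isHomogeneous n f
    rw [mem_idealOf_of_isHomogeneous hn]
    exact closure_minimal ((mem_idealOf_of_isHomogeneous hn).1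
      (homogeneousComponent_mem_idealOf hf n)) (isClosed_eq_zero hn)

/-- For a homogeneous ideal, primality need only be tested on homogeneous elements, whose
nonvanishing loci are open. -/
theorem idealOf_isPrime {Z : Set (PSpace σ)} (hZ : IsIrreducible Z) : (idealOf Z).IsPrime := by
  let := gradedAlgebra (σ := σ) (R := ℂ)
  have hhom : (idealOf Z).IsHomogeneous (homogeneousSubmodule σ ℂ) := by
    intro i f hf
    have h1 := homogeneousComponent_mem_idealOf hf i
    rwa [← decomposition.decompose'_apply] at h1
  refine hhom.isPrime_of_homogeneous_mem_or_mem (fun h => ?_) ?_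
  · obtain ⟨z, hz⟩ := hZ.nonempty
    have h1 : (1 : MvPolynomial σ ℂ) ∈ idealOf Z := h ▸ Submodule.mem_top
    simpa using mem_idealOf.1 h1 _ (rep_mem_cone hz)
  · rintro f g ⟨d, hf⟩ ⟨e, hg⟩ hfg
    rw [mem_homogeneousSubmodule] at hf hg
    by_contra! hcon
    rw [mem_idealOf_of_isHomogeneous hf, mem_idealOf_of_isHomogeneous hg] at hcon
    push Not at hcon
    obtain ⟨⟨x, hx, hx0⟩, y, hy, hy0⟩ := hcon
    obtain ⟨z, hz, hz1, hz2⟩ := hZ.2 _ _ (isOpen_ne_zero hf) (isOpen_ne_zero hg)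
      ⟨x, hx, hx0⟩ ⟨y, hy, hy0⟩
    have h1 := mem_idealOf.1 hfg _ (rep_mem_cone hz)
    rw [map_mul] at h1
    exact (mul_ne_zero hz1 hz2) h1

/-- A polynomial that vanishes on the part of a cone where some polynomials outside its ideal are
nonzero vanishes on the cone. -/
theorem mem_idealOf_of_ne_zero {Z : Set (PSpace σ)} (hZ : IsIrreducible Z)
    {f : MvPolynomial σ ℂ} {ι : Type*} {s : Finset ι} {E : ι → MvPolynomial σ ℂ}
    (hE : ∀ i ∈ s, E i ∉ idealOf Z)
    (h : ∀ v ∈ cone Z, (∀ i ∈ s, eval v (E i) ≠ 0) → eval v f = 0) : f ∈ idealOf Z := by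
  have := idealOf_isPrime hZ
  have h1 : (∏ i ∈ s, E i) * f ∈ idealOf Z := by
    rw [mem_idealOf]
    intro v hv
    rw [map_mul, map_prod]
    by_cases h2 : ∀ i ∈ s, eval v (E i) ≠ 0
    · rw [h v hv h2, mul_zero]
    · push Not at h2
      obtain ⟨i, hi, h0⟩ := h2
      rw [Finset.prod_eq_zero hi h0, zero_mul]
  refine (Ideal.IsPrime.mem_or_mem ‹_› h1).resolve_left fun h2 => ?_
  obtain ⟨i, hi, h3⟩ := (Ideal.IsPrime.prod_mem_iff).1 h2
  exact hE i hi h3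

theorem exists_X_notMem_idealOf {Z : Set (PSpace σ)} {z : PSpace σ} (hz : z ∈ Z) :
    ∃ i, z.rep i ≠ 0 ∧ (X i : MvPolynomial σ ℂ) ∉ idealOf Z := by
  obtain ⟨i, hi⟩ := Function.ne_iff.1 z.rep_nonzero
  exact ⟨i, hi, fun h => hi (by simpa using mem_idealOf.1 h _ (rep_mem_cone hz))⟩

variable [Fintype σ]

/-- Euler's formula on each homogeneous component; hence the tangent space of a cone at a point
contains that point. -/
theorem sum_X_mul_pderiv_mem_idealOf {Z : Set (PSpace σ)} {f : MvPolynomial σ ℂ}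
    (hf : f ∈ idealOf Z) : ∑ i, X i * pderiv i f ∈ idealOf Z := by
  have h1 : ∑ i, X i * pderiv i f =
      ∑ n ∈ Finset.range (f.totalDegree + 1), n • homogeneousComponent n f := by
    conv_lhs => rw [← sum_homogeneousComponent f]
    simp only [map_sum, Finset.mul_sum]
    rw [Finset.sum_comm]
    exact Finset.sum_congr rfl fun n _ =>
      (homogeneousComponent_isHomogeneous n f).sum_X_mul_pderiv
  rw [h1]
  exact Ideal.sum_mem _ fun n _ => Submodule.smul_of_tower_mem _ n
    (homogeneousComponent_mem_idealOf hf n)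

theorem genericPoint_mem_tan (Z : Set (PSpace σ)) :
    genericPoint (idealOf Z) ∈ tan (idealOf Z) (genericPoint (idealOf Z)) := by
  intro f hf
  have := (aeval_genericPoint_eq_zero _).2 (sum_X_mul_pderiv_mem_idealOf hf)
  simpa using this

theorem tan_smul {Z : Set (PSpace σ)} (v : σ → ℂ) {c : ℂ} (hc : c ≠ 0) :
    tan (idealOf Z) (c • v) = tan (idealOf Z) v := by
  have key : ∀ (c : ℂ) (_ : c ≠ 0) (v : σ → ℂ), tan (idealOf Z) (c • v) ≤ tan (idealOf Z) v := by
    intro c hc v t ht f hf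
    have h1 : ∀ i, pderiv i f = ∑ n ∈ Finset.range (f.totalDegree + 1),
        pderiv i (homogeneousComponent n f) := fun i => by
      conv_lhs => rw [← sum_homogeneousComponent f]
      rw [map_sum]
    simp only [h1, map_sum, Finset.mul_sum]
    rw [Finset.sum_comm]
    refine Finset.sum_eq_zero fun n _ => ?_
    have h2 := ht _ (homogeneousComponent_mem_idealOf hf n)
    have h3 : ∀ i, aeval (c • v) (pderiv i (homogeneousComponent n f)) =
        c ^ (n - 1) * aeval v (pderiv i (homogeneousComponent n f)) := fun i =>
      eval_smul_of_isHomogeneous (homogeneousComponent_isHomogeneous n f).pderiv c v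
    simp only [h3, mul_left_comm _ (c ^ (n - 1)), ← Finset.mul_sum] at h2
    exact (mul_eq_zero.1 h2).resolve_left (pow_ne_zero _ hc)
  refine le_antisymm (key c hc v) ?_
  conv_lhs => rw [← inv_smul_smul₀ hc v]
  exact key c⁻¹ (inv_ne_zero hc) _

/-- The truncated subtraction in `dim` loses nothing: the generic point is a nonzero tangent vector,
so the transcendence degree is positive. -/
theorem dim_add_one {Z : Set (PSpace σ)} (hZ : IsIrreducible Z) :
    dim Z + 1 = Cardinal.toNat (Algebra.trdeg ℂ (MvPolynomial σ ℂ ⧸ idealOf Z)) := by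
  have := idealOf_isPrime hZ
  rw [dim]
  refine Nat.sub_add_cancel ?_
  rw [← finrank_tan_genericPoint, Nat.one_le_iff_ne_zero]
  intro h
  rw [Submodule.finrank_eq_zero] at h
  have h1 := genericPoint_mem_tan Z
  rw [h, Submodule.mem_bot] at h1
  obtain ⟨z, hz⟩ := hZ.nonempty
  obtain ⟨i, -, hi⟩ := exists_X_notMem_idealOf hz
  exact hi ((aeval_genericPoint_eq_zero _).1 ((aeval_X _ i).trans (congrFun h1 i)))

end Cone

theorem ProjVariety.tangent_eq_tan {N : ℕ} (X : ProjVariety (Fin (N + 1)))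
    (x : PSpace (Fin (N + 1))) : X.tangent x = tan (idealOf X.carrier) x.rep := rfl

/-- `D` need not be homogeneous, so its nonvanishing depends on the representative; hence the scalar
`c`. -/
theorem IsGradientProjection.mem_smoothLocus {N : ℕ} {X : ProjVariety (Fin (N + 1))}
    {D : MvPolynomial (Fin (N + 1)) ℂ} {f : Fin (N + 1) → MvPolynomial (Fin (N + 1)) ℂ}
    (h : IsGradientProjection (idealOf X.carrier) D f) {x : PSpace (Fin (N + 1))}
    (hx : x ∈ X.carrier) {c : ℂ} (hc : c ≠ 0) (hD : eval (c • x.rep) D ≠ 0) :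
    x ∈ X.smoothLocus := by
  have := idealOf_isPrime X.isIrreducible
  refine ⟨hx, ?_⟩
  rw [X.tangent_eq_tan, ← tan_smul x.rep hc, dim_add_one X.isIrreducible]
  exact h.finrank_tan_eq_trdeg (fun g hg => mem_idealOf.1 hg _ (mem_cone.2 ⟨x, hx, c, hc, rfl⟩)) hD

/-! ### From Plücker coordinates to hyperplanes -/

section Plucker

variable {d N : ℕ}

/-- Omit one entry of an increasing sequence. -/
def omitIndex (E : Fin (d + 1) ↪o Fin (N + 1)) (k : Fin (d + 1)) : PluckerIndex d N :=
  k.succAboveOrderEmb.trans E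

/-- Any prescribed Plücker coordinate occurs, up to sign, among the coefficients of some hyperplane
form; this serves to make the form nonzero. -/
theorem exists_omitIndex_eq (e : PluckerIndex d N) (hd : d < N + 1) :
    ∃ (E : Fin (d + 1) ↪o Fin (N + 1)) (k : Fin (d + 1)), omitIndex E k = e := by
  classical
  let s := Finset.univ.map e.toEmbedding
  have hs : s.card = d := by simp [s]
  obtain ⟨j, hj⟩ : ∃ j, j ∉ s := by
    by_contra! h
    have := Finset.card_le_card (fun j _ => h j : Finset.univ ⊆ s)
    rw [hs, Finset.card_univ, Fintype.card_fin] at this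
    omega
  have hs' : (insert j s).card = d + 1 := by rw [Finset.card_insert_of_notMem hj, hs]
  let E := (insert j s).orderEmbOfFin hs'
  have hE : Set.range E = insert j (Set.range e) := by
    rw [Finset.range_orderEmbOfFin, Finset.coe_insert]
    simp [s]
  obtain ⟨k, hk⟩ : j ∈ Set.range E := hE ▸ Set.mem_insert _ _
  refine ⟨E, k, OrderEmbedding.range_inj.1 ?_⟩
  have h1 : Set.range (omitIndex E k) = E '' {k}ᶜ := by
    rw [← Fin.range_succAbove, ← Set.range_comp]
    rfl
  have hj' : j ∉ Set.range e := by simpa [s] using hj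
  rw [h1, Set.image_compl_eq_range_sdiff_image E.injective, hE, Set.image_singleton, hk]
  simp [hj']

/-- The linear forms in the Plücker coordinates of a `d`-dimensional subspace `W` that are the
coefficients of the equation of the hyperplane spanned by `W` and the coordinate vectors whose
index is not in the range of `E`. -/
def hyperplaneForm (E : Fin (d + 1) ↪o Fin (N + 1)) (i : Fin (N + 1)) :
    MvPolynomial (PluckerIndex d N) ℂ :=
  ∑ k, if E k = i then C ((-1) ^ (k : ℕ)) * X (omitIndex E k) else 0

theorem hyperplaneForm_isHomogeneous (E : Fin (d + 1) ↪o Fin (N + 1)) (i : Fin (N + 1)) :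
    (hyperplaneForm E i).IsHomogeneous 1 := by
  refine IsHomogeneous.sum _ _ _ fun k _ => ?_
  split_ifs
  · exact isHomogeneous_C_mul_X _ _
  · exact isHomogeneous_zero _ _ _

theorem eval_hyperplaneForm_apply (E : Fin (d + 1) ↪o Fin (N + 1)) (k : Fin (d + 1))
    (p : PluckerIndex d N → ℂ) :
    eval p (hyperplaneForm E (E k)) = (-1) ^ (k : ℕ) * p (omitIndex E k) := by
  rw [hyperplaneForm, map_sum, Finset.sum_eq_single k]
  · simp
  · intro l _ hl
    rw [if_neg (fun h => hl (E.injective h)), map_zero]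
  · simp

theorem sum_mul_eval_hyperplaneForm (E : Fin (d + 1) ↪o Fin (N + 1))
    (A : Matrix (Fin d) (Fin (N + 1)) ℂ) {w : Fin (N + 1) → ℂ}
    (hw : w ∈ Submodule.span ℂ (Set.range A.row)) :
    ∑ i, w i * eval (minors A) (hyperplaneForm E i) = 0 := by
  induction hw using Submodule.span_induction with
  | zero => simp
  | add u v _ _ hu hv => simp only [Pi.add_apply, add_mul, Finset.sum_add_distrib, hu, hv, add_zero]
  | smul c u _ hu =>
    simp only [Pi.smul_apply, smul_eq_mul, mul_assoc, ← Finset.mul_sum, hu, mul_zero]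
  | mem w hw =>
    obtain ⟨r, rfl⟩ := hw
    -- Row `r` appears twice; Laplace expansion along the extra copy is the required relation.
    let M : Matrix (Fin (d + 1)) (Fin (d + 1)) ℂ :=
      Matrix.of (Fin.cons (fun k => A r (E k)) fun s k => A s (E k))
    have hM : M.det = 0 := Matrix.det_zero_of_row_eq (Fin.succ_ne_zero r).symm (by ext k; simp [M])
    rw [Matrix.det_succ_row_zero] at hM
    rw [← hM]
    simp only [hyperplaneForm, map_sum, Finset.mul_sum]
    rw [Finset.sum_comm]
    refine Finset.sum_congr rfl fun k _ => ?_
    rw [Finset.sum_eq_single (E k)]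
    · have : (M.submatrix Fin.succ k.succAbove).det = minors A (omitIndex E k) := rfl
      rw [this]
      simp [M]
      ring
    · intro i _ hi
      simp [hi.symm]
    · simp

end Plucker

/-! ### Rational maps -/

section RatMap

variable {σ ρ : Type}

theorem eval_aeval_eq (H : ρ → MvPolynomial σ ℂ) (v : σ → ℂ) (f : MvPolynomial ρ ℂ) :
    eval v (aeval H f) = eval (fun i => eval v (H i)) f := by
  rw [← coe_aeval_eq_eval, ← coe_aeval_eq_eval, RingHom.coe_coe, RingHom.coe_coe,
    ← AlgHom.comp_apply, comp_aeval]

namespace RatMap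

variable {X : ProjVariety σ} (F : RatMap X ρ)

/-- The values of the polynomials that represent a rational map. -/
def vec (v : σ → ℂ) : ρ → ℂ := fun i => eval v (F.poly i)

theorem vec_smul (c : ℂ) (v : σ → ℂ) : F.vec (c • v) = c ^ F.deg • F.vec v := by
  funext i
  exact eval_smul_of_isHomogeneous (F.homogeneous i) c v

theorem eval_aeval_poly (v : σ → ℂ) (f : MvPolynomial ρ ℂ) :
    eval v (aeval F.poly f) = eval (F.vec v) f :=
  eval_aeval_eq _ _ _

variable {F}

theorem MapsTo.exists_vec_eq {x : PSpace σ} {y : PSpace ρ} (h : F.MapsTo x y) :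
    ∃ e : ℂ, e ≠ 0 ∧ F.vec x.rep = e • y.rep := by
  obtain ⟨-, h0, rfl⟩ := h
  exact exists_smul_rep h0

theorem exists_mapsTo {x : PSpace σ} (hx : x ∈ X.carrier) {c : ℂ}
    (h : F.vec (c • x.rep) ≠ 0) :
    ∃ y, F.MapsTo x y ∧ ∃ e : ℂ, e ≠ 0 ∧ F.vec (c • x.rep) = e • y.rep := by
  rw [vec_smul] at h ⊢
  have h1 : F.vec x.rep ≠ 0 := right_ne_zero_of_smul h
  obtain ⟨e, he, h2⟩ := exists_smul_rep h1
  refine ⟨_, ⟨hx, h1, rfl⟩, c ^ F.deg * e, mul_ne_zero (left_ne_zero_of_smul h) he, ?_⟩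
  rw [mul_smul]
  exact congrArg _ h2

theorem Dominant.mem_idealOf {Y : ProjVariety ρ} (hF : F.Dominant Y) {f : MvPolynomial ρ ℂ}
    {d : ℕ} (hf : f.IsHomogeneous d) (h : aeval F.poly f ∈ idealOf X.carrier) :
    f ∈ idealOf Y.carrier := by
  rw [← hF, idealOf_closure, mem_idealOf_of_isHomogeneous hf]
  rintro y ⟨x, hxy⟩
  obtain ⟨e, he, h1⟩ := hxy.exists_vec_eq
  have h2 := GaussScroll.mem_idealOf.1 h _ (rep_mem_cone hxy.1)
  rw [eval_aeval_poly, h1, eval_smul_of_isHomogeneous hf] at h2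
  exact (mul_eq_zero.1 h2).resolve_left (pow_ne_zero _ he)

variable (F)

theorem isIrreducible_image : IsIrreducible {y | ∃ x, F.MapsTo x y} := by
  let U : Set (PSpace σ) := {x | F.vec x.rep ≠ 0}
  have hU : IsOpen U := by
    have : U = ⋃ i, {x : PSpace σ | eval x.rep (F.poly i) ≠ 0} := by
      ext x
      simp only [Set.mem_iUnion]
      exact Function.ne_iff
    rw [this]
    exact isOpen_iUnion fun i => isOpen_ne_zero (F.homogeneous i)
  have hDne : (X.carrier ∩ U).Nonempty := by
    obtain ⟨x, hx, i, hi⟩ := F.not_zero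
    exact ⟨x, hx, fun h => hi (congrFun h i)⟩
  have hD : IsIrreducible (X.carrier ∩ U) := by
    refine ⟨hDne, ?_⟩
    rintro A B hA hB ⟨a, ⟨ha, haU⟩, haA⟩ ⟨b, ⟨hb, hbU⟩, hbB⟩
    obtain ⟨c, hc, ⟨hcU, hcA⟩, -, hcB⟩ := X.isIrreducible.2 _ _ (hU.inter hA) (hU.inter hB)
      ⟨a, ha, haU, haA⟩ ⟨b, hb, hbU, hbB⟩
    exact ⟨c, ⟨hc, hcU⟩, hcA, hcB⟩
  have := Subtype.irreducibleSpace hD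
  let f : ↥(X.carrier ∩ U) → PSpace ρ := fun x => Projectivization.mk ℂ (F.vec x.1.rep) x.2.2
  have hf : Continuous f := by
    rw [continuous_generateFrom_iff]
    rintro _ ⟨g, d, hg, rfl⟩
    have h1 : IsOpen {x : PSpace σ | eval x.rep (aeval F.poly g) ≠ 0} :=
      isOpen_ne_zero (hg.aeval _ F.homogeneous)
    convert! h1.preimage continuous_subtype_val using 1
    ext x
    obtain ⟨e, he, h2⟩ := exists_smul_rep x.2.2
    simp only [Set.mem_preimage, Set.mem_ofPred_eq, eval_aeval_poly]
    rw [h2, eval_smul_of_isHomogeneous hg, mul_ne_zero_iff, and_iff_right (pow_ne_zero _ he)]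
  have h1 := (IrreducibleSpace.isIrreducible_univ ↥(X.carrier ∩ U)).image f hf.continuousOn
  convert! h1 using 1
  ext y
  simp only [Set.image_univ, Set.mem_range, Set.mem_ofPred_eq]
  constructor
  · rintro ⟨x, hx, h, rfl⟩
    exact ⟨⟨x, hx, h⟩, rfl⟩
  · rintro ⟨x, rfl⟩
    exact ⟨x.1, x.2.1, x.2.2, rfl⟩

/-- The closure of the image of a rational map. -/
def image : ProjVariety ρ where
  carrier := closure {y | ∃ x, F.MapsTo x y}
  isClosed := isClosed_closure
  isIrreducible := isIrreducible_iff_closure.2 F.isIrreducible_image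

theorem dominant_image : F.Dominant F.image := rfl

end RatMap

/-- The image of `q` is a subalgebra of the coordinate ring of `Z`, and it surjects onto that of
`Y`; neither step raises the transcendence degree. -/
theorem dim_le_dim_of_aeval_mem [Finite ρ] {Y : Set (PSpace σ)} {Z : Set (PSpace ρ)}
    (ψ : σ → MvPolynomial ρ ℂ) (h : ∀ f, aeval ψ f ∈ idealOf Z → f ∈ idealOf Y) :
    dim Y ≤ dim Z := by
  let q : MvPolynomial σ ℂ →ₐ[ℂ] MvPolynomial ρ ℂ ⧸ idealOf Z :=
    (Ideal.Quotient.mkₐ ℂ (idealOf Z)).comp (aeval ψ)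
  have hq : RingHom.ker q ≤ idealOf Y := fun f hf => h f (Ideal.Quotient.eq_zero_iff_mem.1 hf)
  refine Nat.sub_le_sub_right (Cardinal.toNat_le_toNat ?_ trdeg_lt_aleph0_of_finiteType) 1
  exact (trdeg_le_of_surjective (Ideal.Quotient.factorₐ ℂ hq)
    (Ideal.Quotient.factor_surjective hq)).trans
    (trdeg_le_of_injective _ (Ideal.kerLiftAlg_injective q))

end RatMap

/-! ### The hyperplane section of a Gauss map scroll -/

section Main

variable {N : ℕ} {X : ProjVariety (Fin (N + 1))} {σ : Type} {B : ProjVariety σ}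

/-- The composition of a rational map to the Grassmannian with the linear projection given by
the hyperplane forms. -/
def hyperplaneMap {d : ℕ} (τ : RatMap B (PluckerIndex d N)) (E : Fin (d + 1) ↪o Fin (N + 1))
    (h : ∃ x ∈ B.carrier, ∃ k, eval x.rep (τ.poly (omitIndex E k)) ≠ 0) :
    RatMap B (Fin (N + 1)) where
  deg := τ.deg * 1
  poly i := aeval τ.poly (hyperplaneForm E i)
  homogeneous i := (hyperplaneForm_isHomogeneous E i).aeval _ τ.homogeneous
  not_zero := by
    obtain ⟨x, hx, k, hk⟩ := h
    refine ⟨x, hx, E k, ?_⟩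
    rw [τ.eval_aeval_poly, eval_hyperplaneForm_apply]
    exact mul_ne_zero (pow_ne_zero _ (by norm_num)) hk

/-- At smooth points where the factorization of the Gauss map is defined, it computes the
Plücker coordinates of the tangent space. -/
theorem exists_mem_gaussImage {π : RatMap X σ}
    {τ : RatMap B (PluckerIndex (dim X.carrier + 1) N)} (hπ : π.Dominant B)
    (hτ : ∀ x ∈ X.smoothLocus, ∀ b p, π.MapsTo x b → τ.MapsTo b p →
      IsPluckerPoint (X.tangent x) p)
    (E : Fin (dim X.carrier + 1 + 1) ↪o Fin (N + 1)) {x : PSpace (Fin (N + 1))}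
    (hx : x ∈ X.smoothLocus) {c : ℂ} (hc : c ≠ 0) (h1 : π.vec (c • x.rep) ≠ 0)
    (h2 : τ.vec (π.vec (c • x.rep)) ≠ 0) :
    τ.vec (π.vec (c • x.rep)) ∈ cone X.gaussImage ∧
      ∀ w ∈ tan (idealOf X.carrier) (c • x.rep),
        ∑ i, w i * eval (τ.vec (π.vec (c • x.rep))) (hyperplaneForm E i) = 0 := by
  obtain ⟨b, hxb, e, he, hb⟩ := π.exists_mapsTo hx.1 h1
  rw [hb] at h2 ⊢
  have hbB : b ∈ B.carrier := hπ ▸ subset_closure ⟨x, hxb⟩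
  obtain ⟨p, hbp, e', he', hp⟩ := τ.exists_mapsTo hbB h2
  rw [hp]
  have hPl := hτ x hx b p hxb hbp
  refine ⟨mem_cone.2 ⟨p, ⟨x, hx, hPl⟩, e', he', rfl⟩, fun w hw => ?_⟩
  obtain ⟨A, hA, hA0, rfl⟩ := hPl
  rw [tan_smul _ hc, ← X.tangent_eq_tan, ← hA] at hw
  obtain ⟨a, ha, hAa⟩ := exists_smul_rep hA0
  have h3 := sum_mul_eval_hyperplaneForm E A hw
  rw [hAa] at h3
  simp only [eval_smul_of_isHomogeneous (hyperplaneForm_isHomogeneous E _), mul_left_comm _ (_ ^ 1),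
    ← Finset.mul_sum] at h3 ⊢
  rw [(mul_eq_zero.1 h3).resolve_left (pow_ne_zero _ ha), mul_zero]

variable {π : RatMap X σ} {φ : RatMap B (Fin (N + 1))} {k : Fin (N + 1)}

/-- The composition of `π` and `φ`, multiplied by a coordinate. -/
def coneMap (π : RatMap X σ) (φ : RatMap B (Fin (N + 1))) (k i : Fin (N + 1)) :
    MvPolynomial (Fin (N + 1)) ℂ :=
  MvPolynomial.X k * aeval π.poly (φ.poly i)

theorem coneMap_isHomogeneous (π : RatMap X σ) (φ : RatMap B (Fin (N + 1)))
    (k i : Fin (N + 1)) : (coneMap π φ k i).IsHomogeneous (1 + π.deg * φ.deg) :=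
  (isHomogeneous_X _ k).mul ((φ.homogeneous i).aeval _ π.homogeneous)

theorem eval_coneMap (v : Fin (N + 1) → ℂ) :
    (fun i => eval v (coneMap π φ k i)) = v k • φ.vec (π.vec v) := by
  funext i
  rw [coneMap, map_mul, eval_X, π.eval_aeval_poly]
  rfl

theorem exists_poly_notMem_idealOf {σ ρ : Type} {X : ProjVariety σ} (F : RatMap X ρ) :
    ∃ i, F.poly i ∉ idealOf X.carrier := by
  obtain ⟨x, hx, i, hi⟩ := F.not_zero
  exact ⟨i, fun h => hi (mem_idealOf.1 h _ (rep_mem_cone hx))⟩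

/-- The factor `X k` makes the degree of `coneMap` positive even if `π` or `φ` has degree zero.
Scalars then have roots of that order, so the image of the cone is stable under scaling and
inhomogeneous `f` can be treated by components. -/
theorem aeval_coneMap_mem_iff (hπ : π.Dominant B) (hk : MvPolynomial.X k ∉ idealOf X.carrier)
    (f : MvPolynomial (Fin (N + 1)) ℂ) :
    aeval (coneMap π φ k) f ∈ idealOf X.carrier ↔ f ∈ idealOf φ.image.carrier := by
  have hprime := idealOf_isPrime X.isIrreducible
  constructor
  · intro h
    refine mem_of_homogeneousComponent_mem fun n => ?_
    have hn := homogeneousComponent_isHomogeneous n f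
    refine φ.dominant_image.mem_idealOf hn (hπ.mem_idealOf (hn.aeval _ φ.homogeneous) ?_)
    have h1 : MvPolynomial.X k ^ n * aeval π.poly (aeval φ.poly (homogeneousComponent n f)) ∈
        idealOf X.carrier := by
      refine mem_idealOf.2 fun v hv => ?_
      rw [map_mul, map_pow, eval_X, π.eval_aeval_poly, φ.eval_aeval_poly,
        ← eval_smul_of_isHomogeneous hn, ← eval_coneMap]
      refine eval_homogeneousComponent_eq_zero (fun c hc => ?_) n
      obtain ⟨s, hs⟩ := IsAlgClosed.exists_pow_nat_eq c
        (Nat.add_pos_left one_pos (π.deg * φ.deg))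
      have hs0 : s ≠ 0 := by
        rintro rfl
        rw [zero_pow (by omega)] at hs
        exact hc hs.symm
      have h2 := mem_idealOf.1 h _ (smul_mem_cone hv hs0)
      rw [eval_aeval_eq] at h2
      rw [← h2, ← hs]
      congr 2
      funext i
      exact (eval_smul_of_isHomogeneous (coneMap_isHomogeneous π φ k i) s v).symm
    exact (hprime.mem_or_mem h1).resolve_left fun h2 => hk (hprime.mem_of_pow_mem n h2)
  · intro h
    obtain ⟨l, hl⟩ := exists_poly_notMem_idealOf π
    obtain ⟨j, hj⟩ := exists_poly_notMem_idealOf φ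
    refine mem_idealOf_of_ne_zero X.isIrreducible (s := Finset.univ)
      (E := ![MvPolynomial.X k, π.poly l, aeval π.poly (φ.poly j)]) ?_ ?_
    · simp only [Finset.mem_univ, true_implies, Fin.forall_fin_succ, Matrix.cons_val_zero,
        Matrix.cons_val_succ, IsEmpty.forall_iff, and_true]
      exact ⟨hk, hl, fun h => hj (hπ.mem_idealOf (φ.homogeneous j) h)⟩
    · simp only [Finset.mem_univ, true_implies, Fin.forall_fin_succ, Matrix.cons_val_zero,
        Matrix.cons_val_succ, IsEmpty.forall_iff, and_true, eval_X, π.eval_aeval_poly]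
      rintro v hv ⟨hvk, hvl, hvj⟩
      obtain ⟨x, hx, c, hc, rfl⟩ := mem_cone.1 hv
      have h1 : π.vec (c • x.rep) ≠ 0 := fun h => hvl (congrFun h l)
      have h2 : φ.vec (π.vec (c • x.rep)) ≠ 0 := fun h => hvj (congrFun h j)
      obtain ⟨b, hxb, e, he, hb⟩ := π.exists_mapsTo hx h1
      have hbB : b ∈ B.carrier := hπ ▸ subset_closure ⟨x, hxb⟩
      rw [hb] at h2
      obtain ⟨y, hby, e', he', hy⟩ := φ.exists_mapsTo hbB h2
      rw [eval_aeval_eq, eval_coneMap, hb, hy, smul_smul]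
      exact mem_idealOf.1 h _ (mem_cone.2 ⟨y, subset_closure ⟨b, hby⟩, _,
        mul_ne_zero hvk he', rfl⟩)

/-- If the hyperplane `φ (π x)` contains the tangent space at `x` for general `x`, then the
tangent space of the image of `φ` at a general point `φ b` annihilates the fibre of `π`
over `b`. -/
theorem generically_tangent_image_le_perp (hπ : π.Dominant B)
    (hT : ∀ t ∈ tan (idealOf X.carrier) (genericPoint (idealOf X.carrier)),
      ∑ i, t i * aeval (genericPoint (idealOf X.carrier)) (aeval π.poly (φ.poly i)) = 0) :
    ∃ (f : MvPolynomial σ ℂ) (d : ℕ), f.IsHomogeneous d ∧ f ∉ idealOf B.carrier ∧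
      ∀ b y, φ.MapsTo b y → eval b.rep f ≠ 0 → ∀ x, π.MapsTo x b →
        ∀ w ∈ φ.image.tangent y, x.rep ⬝ᵥ w = 0 := by
  have hprimeX := idealOf_isPrime X.isIrreducible
  have hprimeY := idealOf_isPrime φ.image.isIrreducible
  obtain ⟨D, F, hDF⟩ := exists_isGradientProjection (idealOf φ.image.carrier)
  -- A homogeneous component defines an open condition on `b`; where it is nonzero, `D` is nonzero
  -- at some multiple of `φ.vec b.rep`.
  obtain ⟨n, hn⟩ : ∃ n, homogeneousComponent n D ∉ idealOf φ.image.carrier := by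
    by_contra! h
    exact hDF.notMem (mem_of_homogeneousComponent_mem h)
  have hnh := homogeneousComponent_isHomogeneous n D
  refine ⟨aeval φ.poly (homogeneousComponent n D), _, hnh.aeval _ φ.homogeneous, ?_, ?_⟩
  · intro h
    exact hn (φ.dominant_image.mem_idealOf hnh h)
  intro b y hby hb x hxb w hw
  -- The coordinate `k` may depend on `x`, because `D`, `F` and the condition on `b` do not involve
  -- it; thus the whole fibre is covered.
  obtain ⟨k, hxk, hk⟩ := exists_X_notMem_idealOf hxb.1
  have hTk : ∀ t ∈ tan (idealOf X.carrier) (genericPoint (idealOf X.carrier)),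
      ∑ i, t i * aeval (genericPoint (idealOf X.carrier)) (coneMap π φ k i) = 0 := by
    intro t ht
    simp only [coneMap, map_mul, mul_left_comm (t _), ← Finset.mul_sum, hT t ht, mul_zero]
  -- The generic point is itself a tangent vector, so incidence is a case of `hTk`.
  have hE : ∑ i, MvPolynomial.X i * coneMap π φ k i ∈ idealOf X.carrier := by
    rw [← aeval_genericPoint_eq_zero, map_sum, ← hTk _ (genericPoint_mem_tan X.carrier)]
    simp only [map_mul, aeval_X]
  have key := hDF.mem_of_dominant (aeval_coneMap_mem_iff hπ hk) hTk hE
  obtain ⟨e, he, hxe⟩ := hxb.exists_vec_eq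
  obtain ⟨a, ha, hya⟩ := hby.exists_vec_eq
  rw [φ.eval_aeval_poly] at hb
  obtain ⟨c, hc, hcD⟩ : ∃ c : ℂ, c ≠ 0 ∧ eval (c • φ.vec b.rep) D ≠ 0 := by
    by_contra! h
    exact hb (eval_homogeneousComponent_eq_zero h n)
  have hm : 0 < 1 + π.deg * φ.deg := by omega
  have hr : x.rep k * e ^ φ.deg ≠ 0 := mul_ne_zero hxk (pow_ne_zero _ he)
  -- Rescale `x` so that `coneMap` sends it exactly to `c • φ.vec b.rep`, where `D` is nonzero.
  obtain ⟨s, hs⟩ := IsAlgClosed.exists_pow_nat_eq (c / (x.rep k * e ^ φ.deg)) hm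
  have hs0 : s ≠ 0 := by
    rintro rfl
    rw [zero_pow hm.ne'] at hs
    exact div_ne_zero hc hr hs.symm
  have hH : (fun i => eval (s • x.rep) (coneMap π φ k i)) = c • φ.vec b.rep := by
    have h1 : (fun i => eval (s • x.rep) (coneMap π φ k i)) =
        s ^ (1 + π.deg * φ.deg) • fun i => eval x.rep (coneMap π φ k i) := by
      funext i
      exact eval_smul_of_isHomogeneous (coneMap_isHomogeneous π φ k i) s _
    rw [h1, eval_coneMap, hxe, φ.vec_smul, hs, smul_smul, smul_smul, mul_assoc, div_mul_cancel₀ _ hr]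
  have hrel : ∀ j, eval (c • φ.vec b.rep) D * (s * x.rep j) =
      ∑ i, (s * x.rep i) * eval (c • φ.vec b.rep) (pderiv j (F i)) := by
    intro j
    have h1 := mem_idealOf.1 (key j) (s • x.rep) (mem_cone.2 ⟨x, hxb.1, s, hs0, rfl⟩)
    rw [map_sub, sub_eq_zero, map_mul, map_sum] at h1
    simpa only [map_mul, eval_aeval_eq, hH, eval_X, Pi.smul_apply, smul_eq_mul] using h1
  have hw' : w ∈ tan (idealOf φ.image.carrier) (c • φ.vec b.rep) := by
    rwa [hya, smul_smul, tan_smul _ (mul_ne_zero hc ha)]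
  refine (mul_eq_zero.1 ?_).resolve_left (mul_ne_zero hcD hs0)
  calc eval (c • φ.vec b.rep) D * s * (x.rep ⬝ᵥ w)
      = ∑ j, (eval (c • φ.vec b.rep) D * (s * x.rep j)) * w j := by
        rw [dotProduct, Finset.mul_sum]
        exact Finset.sum_congr rfl fun j _ => by ring
    _ = ∑ i, (s * x.rep i) * ∑ j, w j * eval (c • φ.vec b.rep) (pderiv j (F i)) := by
        simp only [hrel, Finset.sum_mul, Finset.mul_sum]
        rw [Finset.sum_comm]
        exact Finset.sum_congr rfl fun i _ => Finset.sum_congr rfl fun j _ => by ring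
    _ = 0 := Finset.sum_eq_zero fun i _ => by
        have := hw' _ (hDF.mem i)
        rw [show ∑ j, w j * eval (c • φ.vec b.rep) (pderiv j (F i)) = 0 from this, mul_zero]

end Main

/-! ### General points and the conclusion -/

theorem ProjVariety.Generically.and {σ : Type} {X : ProjVariety σ} {P Q : PSpace σ → Prop}
    (hP : X.Generically P) (hQ : X.Generically Q) : X.Generically fun x => P x ∧ Q x := by
  obtain ⟨U, hU, hXU, h⟩ := hP
  obtain ⟨V, hV, hXV, h'⟩ := hQ
  exact ⟨U ∩ V, hU.inter hV, X.isIrreducible.2 U V hU hV hXU hXV,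
    fun x hx => ⟨h x ⟨hx.1, hx.2.1⟩, h' x ⟨hx.1, hx.2.2⟩⟩⟩

theorem ProjVariety.generically_ne_zero {σ : Type} {X : ProjVariety σ} {f : MvPolynomial σ ℂ}
    {d : ℕ} (hf : f.IsHomogeneous d) (h : f ∉ idealOf X.carrier) :
    X.Generically fun x => x ∈ X.carrier ∧ eval x.rep f ≠ 0 := by
  refine ⟨_, isOpen_ne_zero hf, ?_, fun x hx => hx⟩
  rw [mem_idealOf_of_isHomogeneous hf] at h
  push Not at h
  exact h

/-- A Gauss map scroll of a variety of positive codimension is a subscroll of the linear dual of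
the tangent scroll of a variety whose dimension is at most the Gauss dimension. -/
theorem IsGaussMapScroll.exists_isSubscroll {N : ℕ} {X : ProjVariety (Fin (N + 1))}
    (hc : 0 < X.codim) {S : Scroll N} (hS : IsGaussMapScroll X S) :
    ∃ Y : ProjVariety (Fin (N + 1)), dim Y.carrier ≤ X.gaussDim ∧
      S.IsSubscroll (tangentScroll Y).linearDual := by
  have hprime := idealOf_isPrime X.isIrreducible
  obtain ⟨π, τ, hπ, -, hτ, -, hrul⟩ := hS
  obtain ⟨b₀, hb₀, e₀, he₀⟩ := τ.not_zero
  -- Positive codimension leaves room for one more index; starting from a coordinate `e₀` of `τ` not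
  -- vanishing on `B` keeps `φ` from being identically zero.
  obtain ⟨E, k₀, rfl⟩ := exists_omitIndex_eq e₀ (by unfold ProjVariety.codim at hc; omega)
  let φ := hyperplaneMap τ E ⟨b₀, hb₀, k₀, he₀⟩
  have hφ : ∀ u i, φ.vec u i = eval (τ.vec u) (hyperplaneForm E i) := fun u i =>
    τ.eval_aeval_poly u _
  obtain ⟨D, F, hDF⟩ := exists_isGradientProjection (idealOf X.carrier)
  obtain ⟨l, hl⟩ := exists_poly_notMem_idealOf π
  obtain ⟨q, hq⟩ := exists_poly_notMem_idealOf τ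
  obtain ⟨x₀, hx₀⟩ := X.isIrreducible.nonempty
  obtain ⟨k, -, hk⟩ := exists_X_notMem_idealOf hx₀
  -- Membership in the prime ideal of `X` may be checked where `D ≠ 0` (smooth points) and `π`, `τ`
  -- are defined, so that the Gauss map is available.
  have hgen : ∀ g : MvPolynomial (Fin (N + 1)) ℂ, (∀ v ∈ cone X.carrier, eval v D ≠ 0 → v k ≠ 0 →
      τ.vec (π.vec v) ∈ cone X.gaussImage → (∀ w ∈ tan (idealOf X.carrier) v,
        ∑ i, w i * eval (τ.vec (π.vec v)) (hyperplaneForm E i) = 0) → eval v g = 0) →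
      g ∈ idealOf X.carrier := by
    intro g hg
    refine mem_idealOf_of_ne_zero X.isIrreducible (s := Finset.univ)
      (E := ![D, MvPolynomial.X k, π.poly l, aeval π.poly (τ.poly q)]) ?_ ?_
    · simp only [Finset.mem_univ, true_implies, Fin.forall_fin_succ, Matrix.cons_val_zero,
        Matrix.cons_val_succ, IsEmpty.forall_iff, and_true]
      exact ⟨hDF.notMem, hk, hl, fun h => hq (hπ.mem_idealOf (τ.homogeneous q) h)⟩
    · simp only [Finset.mem_univ, true_implies, Fin.forall_fin_succ, Matrix.cons_val_zero,
        Matrix.cons_val_succ, IsEmpty.forall_iff, and_true, eval_X, π.eval_aeval_poly]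
      rintro v hv ⟨hvD, hvk, hvl, hvq⟩
      obtain ⟨x, hx, c, hc, rfl⟩ := mem_cone.1 hv
      obtain ⟨h1, h2⟩ := exists_mem_gaussImage hπ hτ E (hDF.mem_smoothLocus hx hc hvD) hc
        (fun h => hvl (congrFun h l)) (fun h => hvq (congrFun h q))
      exact hg _ hv hvD hvk h1 h2
  refine ⟨φ.image, ?_, φ, φ.dominant_image, ?_⟩
  · refine dim_le_dim_of_aeval_mem (hyperplaneForm E) fun f hf => ?_
    rw [← aeval_coneMap_mem_iff hπ hk]
    refine hgen _ fun v hv _ hvk h1 _ => ?_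
    rw [idealOf_closure] at hf
    have h2 := mem_idealOf.1 hf _ (smul_mem_cone h1 hvk)
    rw [eval_aeval_eq] at h2 ⊢
    rw [← h2, eval_coneMap]
    congr 2
    funext i
    rw [Pi.smul_apply, hφ, eval_smul_of_isHomogeneous (hyperplaneForm_isHomogeneous E i), pow_one,
      smul_eq_mul]
  · have hT : ∀ t ∈ tan (idealOf X.carrier) (genericPoint (idealOf X.carrier)),
        ∑ i, t i * aeval (genericPoint (idealOf X.carrier)) (aeval π.poly (φ.poly i)) = 0 := by
      -- A covector annihilating the tangent space is, up to the factor `D`, reproduced by the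
      -- gradient projection. This form of annihilation is polynomial, so it passes to the generic
      -- point.
      have hT' : ∀ j, D * aeval π.poly (φ.poly j) -
          ∑ i, aeval π.poly (φ.poly i) * pderiv j (F i) ∈ idealOf X.carrier := by
        intro j
        refine hgen _ fun v hv hvD _ _ h2 => ?_
        have hv0 : ∀ g ∈ idealOf X.carrier, aeval v g = 0 := fun g hg => mem_idealOf.1 hg v hv
        have h3 := h2 (fun i => (if i = j then eval v D else 0) - eval v (pderiv j (F i))) (by
          intro g hg
          have h4 := hDF.sum_eq hv0 hg j
          simp only [sub_mul, Finset.sum_sub_distrib, ite_mul, zero_mul, Finset.sum_ite_eq',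
            Finset.mem_univ, if_true, sub_eq_zero]
          exact h4.symm.trans (Finset.sum_congr rfl fun i _ => mul_comm _ _))
        simp only [sub_mul, Finset.sum_sub_distrib, ite_mul, zero_mul, Finset.sum_ite_eq',
            Finset.mem_univ, if_true] at h3
        rw [map_sub, map_mul, map_sum, ← h3]
        simp only [map_mul, π.eval_aeval_poly]
        congr 1
        · rw [← hφ]
          rfl
        · refine Finset.sum_congr rfl fun i _ => ?_
          rw [← hφ, mul_comm]
          rfl
      intro t ht
      have hD0 : aeval (genericPoint (idealOf X.carrier)) D ≠ 0 := fun h =>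
        hDF.notMem ((aeval_genericPoint_eq_zero _).1 h)
      refine (mul_eq_zero.1 ?_).resolve_left hD0
      have h1 : ∀ j, aeval (genericPoint (idealOf X.carrier)) D *
          aeval (genericPoint (idealOf X.carrier)) (aeval π.poly (φ.poly j)) =
          ∑ i, aeval (genericPoint (idealOf X.carrier)) (aeval π.poly (φ.poly i)) *
            aeval (genericPoint (idealOf X.carrier)) (pderiv j (F i)) := by
        intro j
        have h2 := (aeval_genericPoint_eq_zero _).2 (hT' j)
        rw [map_sub, sub_eq_zero, map_mul, map_sum] at h2
        simpa only [map_mul] using h2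
      rw [Finset.mul_sum]
      simp only [mul_left_comm _ (t _), h1, Finset.mul_sum]
      rw [Finset.sum_comm]
      refine Finset.sum_eq_zero fun i _ => ?_
      simp only [mul_left_comm (t _), ← Finset.mul_sum]
      rw [ht _ (hDF.mem i), mul_zero]
    obtain ⟨f, d, hf, hfB, hperp⟩ := generically_tangent_image_le_perp hπ hT
    obtain ⟨j, hj⟩ := exists_poly_notMem_idealOf φ
    obtain ⟨U, hU, hBU, h⟩ := (hrul.and (ProjVariety.generically_ne_zero hf hfB)).and
      (ProjVariety.generically_ne_zero (φ.homogeneous j) hj)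
    refine ⟨U, hU, hBU, fun b hb => ?_⟩
    obtain ⟨⟨hbS, hbB, hbf⟩, -, hbj⟩ := h b hb
    have hb0 : φ.vec b.rep ≠ 0 := fun h => hbj (congrFun h j)
    refine ⟨_, ⟨hbB, hb0, rfl⟩, ?_⟩
    rw [hbS, Submodule.span_le]
    intro v hv w hw
    obtain ⟨x, hx, c, hc, rfl⟩ := mem_cone.1 hv
    rw [smul_dotProduct, hperp b _ ⟨hbB, hb0, rfl⟩ hbf x hx.2 w hw, smul_zero]

end GaussScroll

end

theorem mainTheorem9 (N : ℕ) (X : GaussScroll.ProjVariety (Fin (N + 1)))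
    (hX : X.Nondegenerate)
    (hg : X.gaussDim * (X.gaussDim - 1) < X.codim)
    (S : GaussScroll.Scroll N) (hS : GaussScroll.IsGaussMapScroll X S) :
    ∃ Y : GaussScroll.ProjVariety (Fin (N + 1)),
      GaussScroll.dim Y.carrier ≤ X.gaussDim ∧
        S.IsSubscroll (GaussScroll.tangentScroll Y).linearDual :=
  hS.exists_isSubscroll (Nat.zero_lt_of_lt hg)
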